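/- For each $k\in\mathbb N$ let $X_k$ be a real Banach space with a normalized Schauder basis $(e_{(k,j)})_{j\in\mathbb N}$ with coordinate functionals $e^*_{(k,j)}\in X_k^*$, and let $Z=\ell^\infty(X_k:k\in\mathbb N)$ be the space of all bounded sequences $(x_k)$, $x_k\in X_k$, with norm $\sup_k\|x_k\|$. Regard $X_k$ as a subspace of $Z$ (sequences supported in the $k$-th coordinate), and let $e^*_{(k,j)}$ act on the $k$-th coordinate of elements of $Z$. **Definitions.** * The identity of a Banach space $X$ *almost $M$-factors through* a bounded linear operator $T\colon X\to X$ if for every $\varepsilon>0$ there are bounded linear operators $A,B\colon X\to X$ with $\|A\|\,\|B\|\le M+\varepsilon$ and $I_X=ATB$. * The array $(e_{(k,j)})$ is *uniformly asymptotically curved* if, whenever $(x_{(k,j)})_j$ is a normalized block basis of $(e_{(k,j)})_j$ for every $k\in\mathbb N$, one has $\lim_{n\to\infty}\sup_k\big\|\frac1n\sum_{j=1}^n x_{(k,j)}\big\|_{X_k}=0$. * For a function $K\colon(0,\infty)\to(0,\infty)$, a normalized Schauder basis $(e_j)$ of $X$ has the *$K$-diagonal factorization property* if for every $\delta>0$ and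 every bounded linear $T\colon X\to X$ with $e_m^*(Te_j)=0$ for $j\ne m$ and $\inf_j|e_j^*(Te_j)|\ge\delta$, the identity of $X$ almost $K(\delta)$-factors through $T$. * Sequences $(x_i)$, $(y_i)$ in normed spaces are *impartially $C$-equivalent* if $\frac1{\sqrt C}\|\sum a_iy_i\|\le\|\sum a_ix_i\|\le\sqrt C\,\|\sum a_iy_i\|$ for all finitely supported real sequences $(a_i)$. * Let $(e_j)$ be a normalized Schauder basis of $X$, $C\ge1$ and $\eta>0$. In the game $\mathrm{Rep}_{(X,(e_j))}(C,\eta)$, Player I first chooses a partition $\mathbb N=N_1\cup N_2$ (a piece may be empty). Then, in turn $n=1,2,\dots$: (Step 1) Player I chooses $\eta_n>0$, a subspace $W_n$ of finite codimension in $X$ and a $w^*$-closed subspace $G_n$ of finite codimension in $X^*$; (Step 2) Player II chooses $i_n\in\{1,2\}$, a finite set $E_n\subset N_{i_n}$ and non-negative reals $(\lambda^{(n)}_i)_{i\in E_n}$, $(\mu^{(n)}_i)_{i\in E_n}$ with $1-\eta<\sum_{i\in E_n}\lambda_i^{(n)}\mu_i^{(n)}<1+\eta$; (Step 3) Player I chooses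 signs $(\varepsilon^{(n)}_i)_{i\in E_n}\in\{-1,1\}^{E_n}$. With $x_n=\sum_{i\in E_n}\varepsilon_i^{(n)}\lambda_i^{(n)}e_i$ and $x_n^*=\sum_{i\in E_n}\varepsilon_i^{(n)}\mu_i^{(n)}e_i^*$, Player II wins if $(x_n)$ and $(e_n)$ are impartially $(C+\eta)$-equivalent, $(x^*_n)$ and $(e^*_n)$ are impartially $(C+\eta)$-equivalent, and $\mathrm{dist}(x_n,W_n)<\eta_n$ and $\mathrm{dist}(x_n^*,G_n)<\eta_n$ for all $n$. The basis $(e_j)$ is *$C$-strategically reproducible* if for every $\eta>0$ Player II has a winning strategy in this game. The array $(e_{(k,j)})$ is *simultaneously $C$-strategically reproducible* if for every $k$ the basis $(e_{(k,j)})_j$ is $C$-strategically reproducible in $X_k$. **Theorem.** Assume that the array $(e_{(k,j)})$ is uniformly asymptotically curved, and that there are $C,\lambda\ge1$ and a map $K\colon(0,\infty)\to(0,\infty)$ such that 1. for every $k$, the basis constant $\sup_n\|P^{(k)}_n\|$ of $(e_{(k,j)})_j$ is at most $\lambda$, where $P^{(k)}_nx=\sum_{j\le n}e^*_{(k,j)}(x)e_{(k,j)}$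 for $x\in X_k$; 2. for every $k$, $(e_{(k,j)})_j$ has the $K$-diagonal factorization property in $X_k$; 3. the array $(e_{(k,j)})$ is simultaneously $C$-strategically reproducible. Let $T\colon Z\to Z$ be bounded and linear with $\delta=\inf_{k,j\in\mathbb N}|e^*_{(k,j)}(Te_{(k,j)})|>0$. Then the identity on $Z$ almost $\lambda C^2K(\delta)$-factors through $T$. -/

import Mathlib

open Filter Topology
open scoped ENNReal

/-- The identity `C`-factors through `T`: there are bounded operators `A`, `B` with
`‖A‖ ‖B‖ ≤ C` and `I = A T B`. -/
def IdFactorsThrough {X : Type*} [NormedAddCommGroup X] [NormedSpace ℝ X]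
    (C : ℝ) (T : X →L[ℝ] X) : Prop :=
  ∃ A B : X →L[ℝ] X, ‖A‖ * ‖B‖ ≤ C ∧ (A.comp T).comp B = ContinuousLinearMap.id ℝ X

/-- The identity almost `C`-factors through `T`. -/
def IdAlmostFactorsThrough {X : Type*} [NormedAddCommGroup X] [NormedSpace ℝ X]
    (C : ℝ) (T : X →L[ℝ] X) : Prop :=
  ∀ ε : ℝ, 0 < ε → IdFactorsThrough (C + ε) T

/-- Two sequences, possibly in different spaces, are impartially `C`-equivalent. -/
def ImpartiallyEquivalent {X Y : Type*} [NormedAddCommGroup X] [NormedSpace ℝ X]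
    [NormedAddCommGroup Y] [NormedSpace ℝ Y] (C : ℝ) (x : ℕ → X) (y : ℕ → Y) : Prop :=
  ∀ (s : Finset ℕ) (a : ℕ → ℝ),
    (1 / √C) * ‖∑ i ∈ s, a i • y i‖ ≤ ‖∑ i ∈ s, a i • x i‖ ∧
      ‖∑ i ∈ s, a i • x i‖ ≤ √C * ‖∑ i ∈ s, a i • y i‖

section SingleSpace

variable {X : Type*} [NormedAddCommGroup X] [NormedSpace ℝ X]

/-- `T` is a diagonal operator with respect to the basis `b`. -/
def IsDiagonalOperator (b : SchauderBasis ℝ X) (T : X →L[ℝ] X) : Prop :=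
  ∀ m j : ℕ, j ≠ m → b.coord m (T (b j)) = 0

/-- The `K`-diagonal factorization property of a basis. -/
def HasDiagonalFactorizationProperty (b : SchauderBasis ℝ X) (K : ℝ → ℝ) : Prop :=
  ∀ δ : ℝ, 0 < δ → ∀ T : X →L[ℝ] X, IsDiagonalOperator b T →
    δ ≤ ⨅ j : ℕ, |b.coord j (T (b j))| → IdAlmostFactorsThrough (K δ) T

/-- `x` is a normalized block basis of `e`: each `x j` has norm one and is a linear combination
of the `e i` with `p j ≤ i < p (j + 1)`, for some strictly increasing `p`. -/
def IsNormalizedBlockBasis (e : ℕ → X) (x : ℕ → X) : Prop :=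
  (∀ j, ‖x j‖ = 1) ∧
    ∃ (p : ℕ → ℕ) (a : ℕ → ℝ), StrictMono p ∧
      ∀ j, x j = ∑ i ∈ Finset.Ico (p j) (p (j + 1)), a i • e i

variable (X) in
/-- What Player I chooses in the first step of a turn: `η_n > 0`, a subspace `W_n` of finite
codimension in `X`, and a weak-star closed subspace `G_n` of finite codimension in the dual. -/
structure RepMoveI where
  eta : ℝ
  eta_pos : 0 < eta
  W : Submodule ℝ X
  W_cofinite : FiniteDimensional ℝ (X ⧸ W)
  G : Submodule ℝ (StrongDual ℝ X)
  G_cofinite : FiniteDimensional ℝ (StrongDual ℝ X ⧸ G)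
  G_weakStarClosed :
    IsClosed ((WeakDual.toStrongDual (𝕜 := ℝ) (E := X)) ⁻¹' (G : Set (StrongDual ℝ X)))

/-- What Player II chooses in the second step of a turn. The partition `ℕ = N₁ ∪ N₂` chosen in the
pregame is encoded by `c : ℕ → Fin 2`, its two pieces being the fibres of `c`. Only the
values of `lam` and `mu` on `E` play a role. -/
structure RepMoveII (c : ℕ → Fin 2) (η : ℝ) where
  piece : Fin 2
  E : Finset ℕ
  E_subset : ∀ i ∈ E, c i = piece
  lam : ℕ → ℝ
  mu : ℕ → ℝ
  lam_nonneg : ∀ i ∈ E, 0 ≤ lam i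
  mu_nonneg : ∀ i ∈ E, 0 ≤ mu i
  lt_sum : 1 - η < ∑ i ∈ E, lam i * mu i
  sum_lt : ∑ i ∈ E, lam i * mu i < 1 + η

/-- The vector `∑_{i ∈ E} ε_i λ_i e_i` produced by a turn. -/
noncomputable def repVector (b : SchauderBasis ℝ X) {c : ℕ → Fin 2} {η : ℝ}
    (r : RepMoveII c η) (ε : ℕ → ℤˣ) : X :=
  ∑ i ∈ r.E, (((ε i : ℤ) : ℝ) * r.lam i) • b i

/-- The functional `∑_{i ∈ E} ε_i μ_i e_i^*` produced by a turn. -/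
noncomputable def repFunctional (b : SchauderBasis ℝ X) {c : ℕ → Fin 2} {η : ℝ}
    (r : RepMoveII c η) (ε : ℕ → ℤˣ) : StrongDual ℝ X :=
  ∑ i ∈ r.E, (((ε i : ℤ) : ℝ) * r.mu i) • b.coord i

/-- The requirements under which Player II wins a completed run of the game: Player I
played `p n` in step 1 and the signs `ε n` in step 3 of turn `n`, Player II played `r n`. -/
def RepWon (b : SchauderBasis ℝ X) (C η : ℝ) {c : ℕ → Fin 2}
    (p : ℕ → RepMoveI X) (r : ℕ → RepMoveII c η) (ε : ℕ → ℕ → ℤˣ) : Prop :=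
  ImpartiallyEquivalent (C + η) (fun n => repVector b (r n) (ε n)) (fun n => b n) ∧
  ImpartiallyEquivalent (C + η) (fun n => repFunctional b (r n) (ε n)) (fun n => b.coord n) ∧
  (∀ n, Metric.infDist (repVector b (r n) (ε n)) ((p n).W : Set X) < (p n).eta) ∧
  (∀ n, Metric.infDist (repFunctional b (r n) (ε n)) ((p n).G : Set (StrongDual ℝ X))
    < (p n).eta)

/-- A strategy of Player II, after the partition `c` has been chosen: the move in turn `n`
depends on the first-step moves of Player I in the turns `0, …, n` and on the signs chosen by
Player I in the turns `0, …, n - 1`. (Signs are recorded on all of `ℕ`; only those on the sets `E`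
matter.) -/
def RepStrategy (X : Type*) [NormedAddCommGroup X] [NormedSpace ℝ X]
    (c : ℕ → Fin 2) (η : ℝ) : Type _ :=
  (n : ℕ) → (Fin (n + 1) → RepMoveI X) → (Fin n → ℕ → ℤˣ) → RepMoveII c η

/-- Player II has a winning strategy in the game `Rep_{(X, b)}(C, η)`. -/
def PlayerIIWinsRep (b : SchauderBasis ℝ X) (C η : ℝ) : Prop :=
  ∀ c : ℕ → Fin 2, ∃ σ : RepStrategy X c η,
    ∀ (p : ℕ → RepMoveI X) (ε : ℕ → ℕ → ℤˣ),
      RepWon b C η p (fun n => σ n (fun m => p m) (fun m => ε m)) ε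

/-- The basis `b` is `C`-strategically reproducible. -/
def StrategicallyReproducible (b : SchauderBasis ℝ X) (C : ℝ) : Prop :=
  ∀ η : ℝ, 0 < η → PlayerIIWinsRep b C η

end SingleSpace

section Arrays

variable {X : ℕ → Type*} [∀ k, NormedAddCommGroup (X k)] [∀ k, NormedSpace ℝ (X k)]

/-- The array of bases is uniformly asymptotically curved. -/
def UniformlyAsymptoticallyCurved (e : ∀ k, SchauderBasis ℝ (X k)) : Prop :=
  ∀ x : ∀ k, ℕ → X k, (∀ k, IsNormalizedBlockBasis (e k) (x k)) →
    Tendsto (fun n : ℕ => ⨆ k : ℕ, ‖(1 / (n : ℝ)) • ∑ j ∈ Finset.range n, x k j‖) atTop (𝓝 0)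

/-- The array is simultaneously `C`-strategically reproducible. -/
def SimultaneouslyStrategicallyReproducible (e : ∀ k, SchauderBasis ℝ (X k)) (C : ℝ) : Prop :=
  ∀ k, StrategicallyReproducible (e k) C

/-- The diagonal entry `e*_{(k,j)}(T e_{(k,j)})` of an operator on `ℓ^∞(X_k)`. -/
noncomputable def arrayDiagonal (e : ∀ k, SchauderBasis ℝ (X k)) (T : lp X ∞ →L[ℝ] lp X ∞)
    (k j : ℕ) : ℝ :=
  (e k).coord j ((T (lp.single ∞ k (e k j)) : lp X ∞) k)

end Arrays

/-! ### Strong limits of operator sequences. -/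

section Limits

variable {X Y : Type*} [NormedAddCommGroup X] [NormedSpace ℝ X]
  [NormedAddCommGroup Y] [NormedSpace ℝ Y]

/-! Vectors `x k j` and functionals `f k j` are built that copy the bases and their coordinate
functionals, such that `f k j` nearly annihilates the `k`-th component of `T` applied to every other
copied vector, while `f k j (T (x k j))` has modulus at least `(1 - η) * δ`. With `B` sending `e k
j` to `x k j`, and `A` having the `f k j` as coordinate functionals, `A T B` is then a small
perturbation of a diagonal operator `D`. The diagonal factorization property inverts `D` one summand
at a time, and a Neumann series absorbs the perturbation.

The difficulty is that the array is not a basis of the `ℓ^∞`-sum, so a functional there need not be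
controlled by its values on the array. Curvedness repairs this
(`UniformlyAsymptoticallyCurved.exists_tail_bound`): if a functional stayed above `ε` on vectors
supported arbitrarily far out in all summands at once, successive normalized blocks would have
averages on which it exceeds `ε`, although the norms of these averages tend to zero.

All games are played simultaneously, in the order of `Nat.pair k j` (`exists_simultaneous_play`).
Player I partitions by the sign of the diagonal and chooses signs that keep the new diagonal entry
large. The subspaces `G` make `f k j` almost vanish on the images of earlier vectors. After each
turn, curvedness supplies thresholds beyond which `f k j ∘ T` is small, and the later subspaces `W`
push later vectors beyond them. Thus both halves of each row are small (`abs_row_le`), summably in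
`j` and uniformly in `k`, which gives `exists_almost_diagonal`. -/

/-- The bound is required of the limits only, so constants that disappear in the limit do not enter
the operator norm. -/
theorem exists_clm_of_tendsto (S : ℕ → X →L[ℝ] Y) {M : ℝ} (hM0 : 0 ≤ M)
    (h : ∀ x, ∃ y, Tendsto (fun n => S n x) atTop (𝓝 y) ∧ ‖y‖ ≤ M * ‖x‖) :
    ∃ L : X →L[ℝ] Y, ‖L‖ ≤ M ∧ ∀ x, Tendsto (fun n => S n x) atTop (𝓝 (L x)) := by
  choose F hF hFM using h
  let L₀ : X →ₗ[ℝ] Y :=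
    { toFun := F
      map_add' := fun x y => tendsto_nhds_unique (hF (x + y)) (by
        simpa only [map_add] using (hF x).add (hF y))
      map_smul' := fun c x => tendsto_nhds_unique (hF (c • x)) (by
        simpa only [map_smul, RingHom.id_apply] using (hF x).const_smul c) }
  exact ⟨L₀.mkContinuous M hFM, L₀.mkContinuous_norm_le hM0 hFM, hF⟩

theorem cauchySeq_of_approx (S : ℕ → X →L[ℝ] Y) {M : ℝ} (hM0 : 0 ≤ M) (hS : ∀ n, ‖S n‖ ≤ M)
    (x : X) (hx : ∀ ε > 0, ∃ y, ‖x - y‖ < ε ∧ CauchySeq fun n => S n y) :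
    CauchySeq fun n => S n x := by
  rw [Metric.cauchySeq_iff']
  intro ε hε
  obtain ⟨y, hxy, hy⟩ := hx (ε / (3 * (M + 1))) (by positivity)
  obtain ⟨N, hN⟩ := Metric.cauchySeq_iff'.1 hy (ε / 3) (by positivity)
  have key : ∀ n, ‖S n (x - y)‖ ≤ ε / 3 := fun n => by
    calc ‖S n (x - y)‖ ≤ M * ‖x - y‖ := (S n).le_of_opNorm_le (hS n) _
      _ ≤ (M + 1) * (ε / (3 * (M + 1))) := by gcongr; linarith
      _ = ε / 3 := by field_simp
  refine ⟨N, fun n hn => ?_⟩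
  have h1 := hN n hn
  rw [dist_eq_norm] at h1 ⊢
  have : S n x - S N x = S n (x - y) + (S n y - S N y) - S N (x - y) := by
    simp only [map_sub]; abel
  rw [this]
  have h2 := norm_sub_le (S n (x - y) + (S n y - S N y)) (S N (x - y))
  have h3 := norm_add_le (S n (x - y)) (S n y - S N y)
  have h4 := key n
  have h5 := key N
  linarith

end Limits

/-! ### Synthesis and analysis operators of a Schauder basis. -/

section SingleSpace

variable {X Y : Type*} [NormedAddCommGroup X] [NormedSpace ℝ X]
  [NormedAddCommGroup Y] [NormedSpace ℝ Y]

namespace SchauderBasis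

theorem coord_basis (b : SchauderBasis ℝ X) (i j : ℕ) :
    b.coord i (b j) = if i = j then 1 else 0 := by
  have := b.ortho i j
  simpa [Pi.single, Function.update] using this

theorem coord_ext (b : SchauderBasis ℝ X) {x y : X} (h : ∀ j, b.coord j x = b.coord j y) :
    x = y := by
  refine tendsto_nhds_unique (tendsto_proj b x) ?_
  convert tendsto_proj b y using 2 with n
  simp [h]

theorem abs_coord_le {b : SchauderBasis ℝ X} (hb1 : ∀ j, ‖b j‖ = 1) {lam : ℝ}
    (hb : ∀ n, ‖proj b n‖ ≤ lam) (j : ℕ) (x : X) : |b.coord j x| ≤ 2 * lam * ‖x‖ := by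
  have h : b.coord j x • b j = proj b (j + 1) x - proj b j x := by
    simp [Finset.sum_range_succ]
  have h' : |b.coord j x| = ‖b.coord j x • b j‖ := by
    rw [norm_smul, hb1, mul_one, Real.norm_eq_abs]
  rw [h', h]
  calc _ ≤ ‖proj b (j + 1) x‖ + ‖proj b j x‖ := norm_sub_le _ _
    _ ≤ lam * ‖x‖ + lam * ‖x‖ := add_le_add ((proj b (j + 1)).le_of_opNorm_le (hb _) _)
        ((proj b j).le_of_opNorm_le (hb _) _)
    _ = _ := by ring

end SchauderBasis

/-- The operator sending a basis to a sequence dominated by it. -/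
theorem exists_synthesis_operator [CompleteSpace Y] (b : SchauderBasis ℝ X) {C : ℝ}
    {x : ℕ → Y} (h : ImpartiallyEquivalent C x (fun n => b n)) :
    ∃ B : X →L[ℝ] Y, ‖B‖ ≤ √C ∧ ∀ z, Tendsto
      (fun n => ∑ j ∈ Finset.range n, b.coord j z • x j) atTop (𝓝 (B z)) := by
  let S : ℕ → X →L[ℝ] Y := fun n => ∑ j ∈ Finset.range n, (b.coord j).smulRight (x j)
  have hS : ∀ n z, S n z = ∑ j ∈ Finset.range n, b.coord j z • x j := fun n z => by
    simp [S]
  obtain ⟨L, hL, hL'⟩ := exists_clm_of_tendsto S (Real.sqrt_nonneg C) (fun z => by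
    have hlim := SchauderBasis.tendsto_proj b z
    have hc : CauchySeq fun n => S n z := by
      rw [Metric.cauchySeq_iff']
      intro ε hε
      obtain ⟨N, hN⟩ := Metric.cauchySeq_iff'.1 hlim.cauchySeq (ε / (√C + 1)) (by positivity)
      refine ⟨N, fun n hn => ?_⟩
      have h1 := hN n hn
      rw [dist_eq_norm] at h1 ⊢
      rw [hS, hS, ← Finset.sum_Ico_eq_sub _ hn]
      rw [SchauderBasis.proj_apply, SchauderBasis.proj_apply, ← Finset.sum_Ico_eq_sub _ hn] at h1
      calc _ ≤ √C * ‖∑ j ∈ Finset.Ico N n, b.coord j z • b j‖ := (h _ _).2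
        _ ≤ √C * (ε / (√C + 1)) := by gcongr
        _ < (√C + 1) * (ε / (√C + 1)) := by
          apply mul_lt_mul_of_pos_right <;> first | linarith | positivity
        _ = ε := by field_simp
    -- The partial sums are bounded by `√C` times the norm of the basis projection of `z`, which
    -- tends to `‖z‖`; hence the basis constant does not enter the norm of this operator.
    obtain ⟨y, hy⟩ := cauchySeq_tendsto_of_complete hc
    refine ⟨y, hy, le_of_tendsto_of_tendsto hy.norm (hlim.norm.const_mul (√C)) ?_⟩
    refine Eventually.of_forall fun n => ?_
    simp only [hS, SchauderBasis.proj_apply]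
    exact (h _ _).2)
  exact ⟨L, hL, fun z => by simpa only [hS] using hL' z⟩

/-- The operator with prescribed coordinate functionals, for a sequence of functionals which is
dominated by the coordinate functionals of the basis. -/
theorem exists_analysis_operator [CompleteSpace X] (b : SchauderBasis ℝ X)
    {lam : ℝ} (hlam : 0 ≤ lam) (hb : ∀ n, ‖SchauderBasis.proj b n‖ ≤ lam) {C : ℝ}
    {f : ℕ → StrongDual ℝ X} (h : ImpartiallyEquivalent C f (fun n => b.coord n))
    (hf : ∀ i, Summable fun j => ‖f j (b i) • b j‖) :
    ∃ A : X →L[ℝ] X, ‖A‖ ≤ lam * √C ∧ ∀ j x, b.coord j (A x) = f j x := by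
  let S : ℕ → X →L[ℝ] X := fun n => ∑ j ∈ Finset.range n, (f j).smulRight (b j)
  have hS : ∀ n z, S n z = ∑ j ∈ Finset.range n, f j z • b j := fun n z => by
    simp [S]
  have hM : 0 ≤ lam * √C := by positivity
  have hSn : ∀ n, ‖S n‖ ≤ lam * √C := fun n => by
    refine ContinuousLinearMap.opNorm_le_bound _ hM fun x => ?_
    -- Duality: testing with a norming `g` turns the partial sum into a combination of the `f j`,
    -- dominated by the same combination of the `b.coord j`, which is `g` composed with a basis
    -- projection. This is where the factor `lam` arises.
    obtain ⟨g, hg, hgx⟩ := exists_dual_vector'' ℝ (S n x)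
    have e1 : ‖S n x‖ = (∑ j ∈ Finset.range n, g (b j) • f j) x := by
      have : g (S n x) = ‖S n x‖ := hgx
      rw [← this, hS, map_sum, sum_apply]
      refine Finset.sum_congr rfl fun j _ => ?_
      simp [mul_comm]
    have e2 : ∑ j ∈ Finset.range n, g (b j) • b.coord j = g.comp (SchauderBasis.proj b n) := by
      ext z
      simp [mul_comm]
    have e3 : ‖g.comp (SchauderBasis.proj b n)‖ ≤ lam := by
      calc _ ≤ ‖g‖ * ‖SchauderBasis.proj b n‖ := ContinuousLinearMap.opNorm_comp_le _ _
        _ ≤ 1 * lam := mul_le_mul hg (hb n) (norm_nonneg _) zero_le_one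
        _ = lam := one_mul _
    rw [e1]
    refine (Real.le_norm_self _).trans (ContinuousLinearMap.le_of_opNorm_le _ ?_ x)
    calc _ ≤ √C * ‖∑ j ∈ Finset.range n, g (b j) • b.coord j‖ := (h _ _).2
      _ ≤ √C * lam := by rw [e2]; gcongr
      _ = _ := mul_comm _ _
  -- Domination in the dual gives boundedness but not convergence. Convergence comes from `hf` on
  -- finite combinations of basis vectors and passes to all `x` by density.
  have hc : ∀ x, CauchySeq fun n => S n x := fun x => by
    refine cauchySeq_of_approx S hM hSn x fun ε hε => ?_
    obtain ⟨N, hN⟩ := Metric.tendsto_atTop.1 (SchauderBasis.tendsto_proj b x) ε hε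
    refine ⟨SchauderBasis.proj b N x, ?_, ?_⟩
    · have := hN N le_rfl
      rwa [dist_comm, dist_eq_norm] at this
    · have e : (fun n => S n (SchauderBasis.proj b N x)) =
          fun n => ∑ i ∈ Finset.range N, b.coord i x • ∑ j ∈ Finset.range n, f j (b i) • b j := by
        funext n
        rw [SchauderBasis.proj_apply, map_sum]
        refine Finset.sum_congr rfl fun i _ => ?_
        rw [map_smul, hS]
      rw [e]
      exact (tendsto_finsetSum _ fun i _ =>
        ((hf i).of_norm.hasSum.tendsto_sum_nat.const_smul (b.coord i x))).cauchySeq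
  obtain ⟨L, hL, hL'⟩ := exists_clm_of_tendsto S hM (fun x => by
    obtain ⟨y, hy⟩ := cauchySeq_tendsto_of_complete (hc x)
    exact ⟨y, hy, le_of_tendsto hy.norm
      (Eventually.of_forall fun n => (S n).le_of_opNorm_le (hSn n) x)⟩)
  refine ⟨L, hL, fun j x => ?_⟩
  refine tendsto_nhds_unique (((b.coord j).continuous.tendsto _).comp (hL' x)) ?_
  refine tendsto_const_nhds.congr' ?_
  filter_upwards [eventually_gt_atTop j] with n hn
  simp [hS, SchauderBasis.coord_basis, hn]

/-- The operator with prescribed coordinate functionals, for an absolutely summable sequence of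
functionals. -/
theorem exists_analysis_operator_of_summable [CompleteSpace X] (b : SchauderBasis ℝ X)
    (hb1 : ∀ j, ‖b j‖ = 1) (r : ℕ → StrongDual ℝ Y) {c : ℕ → ℝ} {M : ℝ} (hc : HasSum c M)
    (hr : ∀ j, ‖r j‖ ≤ c j) :
    ∃ R : Y →L[ℝ] X, ‖R‖ ≤ M ∧ ∀ j z, b.coord j (R z) = r j z := by
  have hn : ∀ j, ‖(r j).smulRight (b j)‖ ≤ c j := fun j => by
    rw [ContinuousLinearMap.norm_smulRight_apply, hb1, mul_one]; exact hr j
  have hs : Summable fun j => (r j).smulRight (b j) := Summable.of_norm_bounded hc.summable hn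
  refine ⟨∑' j, (r j).smulRight (b j), tsum_of_norm_bounded hc hn, fun j z => ?_⟩
  have h1 : HasSum (fun i => b.coord j ((r i).smulRight (b i) z))
      (b.coord j ((∑' i, (r i).smulRight (b i)) z)) :=
    (hs.hasSum.mapL (ContinuousLinearMap.apply ℝ X z)).mapL (b.coord j)
  refine h1.unique ?_
  convert hasSum_ite_eq j (r j z) using 2 with i
  by_cases hij : i = j
  · subst hij; simp [SchauderBasis.coord_basis]
  · simp [SchauderBasis.coord_basis, hij, Ne.symm hij]

end SingleSpace

/-! ### Assembling operators into the `ℓ^∞`-sum. -/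

section Linfty

variable {X : ℕ → Type*} [∀ k, NormedAddCommGroup (X k)] [∀ k, NormedSpace ℝ (X k)]
  {Y : Type*} [NormedAddCommGroup Y] [NormedSpace ℝ Y]

/-- A uniformly bounded family of operators into the summands gives an operator into the
`ℓ^∞`-sum. -/
theorem exists_linfty_lift (L : ∀ k, Y →L[ℝ] X k) {M : ℝ} (hM : 0 ≤ M) (hL : ∀ k, ‖L k‖ ≤ M) :
    ∃ S : Y →L[ℝ] lp X ∞, ‖S‖ ≤ M ∧ ∀ y k, (S y : lp X ∞) k = L k y := by
  have hb : ∀ y k, ‖L k y‖ ≤ M * ‖y‖ := fun y k => (L k).le_of_opNorm_le (hL k) y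
  let S₀ : Y →ₗ[ℝ] lp X ∞ :=
    { toFun := fun y => ⟨fun k => L k y, memℓp_infty ⟨M * ‖y‖, by
        rintro _ ⟨k, rfl⟩; exact hb y k⟩⟩
      map_add' := fun y z => lp.ext (funext fun k => map_add (L k) y z)
      map_smul' := fun c y => lp.ext (funext fun k => map_smul (L k) c y) }
  have hS : ∀ y, ‖S₀ y‖ ≤ M * ‖y‖ := fun y =>
    lp.norm_le_of_forall_le (by positivity) (hb y)
  exact ⟨S₀.mkContinuous M hS, S₀.mkContinuous_norm_le hM hS, fun y k => rfl⟩

end Linfty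

/-! ### Smallness of functionals on tails, from curvedness. -/

/-- In dimension at least two, every point of the unit ball is the midpoint of two unit vectors. -/
theorem exists_unit_midpoint {E : Type*} [NormedAddCommGroup E] [NormedSpace ℝ E]
    (h : 1 < Module.rank ℝ E) {z : E} (hz : ‖z‖ ≤ 1) :
    ∃ u v : E, ‖u‖ = 1 ∧ ‖v‖ = 1 ∧ z = (1 / 2 : ℝ) • (u + v) := by
  have key : ∃ u₀ : E, ‖u₀‖ = 1 ∧ z = ‖z‖ • u₀ := by
    by_cases h0 : z = 0
    · obtain ⟨u, hu⟩ := (isConnected_sphere h 0 zero_le_one).nonempty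
      exact ⟨u, by simpa using hu, by simp [h0]⟩
    · have : ‖z‖ ≠ 0 := norm_ne_zero_iff.2 h0
      exact ⟨‖z‖⁻¹ • z, by rw [norm_smul, norm_inv, norm_norm, inv_mul_cancel₀ this],
        by rw [smul_smul, mul_inv_cancel₀ this, one_smul]⟩
  obtain ⟨u₀, hu₀, hzu⟩ := key
  -- Intermediate value theorem on the connected unit sphere: the distance from `u` to `2 • z` is at
  -- most one at `u₀` and at least one at `-u₀`, so it equals one somewhere.
  have hcont : ContinuousOn (fun u : E => ‖(2 : ℝ) • z - u‖) (Metric.sphere 0 1) := by fun_prop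
  have himg := (isPreconnected_sphere h (0 : E) 1).intermediate_value
    (a := u₀) (b := -u₀) (by simpa using hu₀) (by simpa using hu₀) hcont
  have h1 : ‖(2 : ℝ) • z - u₀‖ ≤ 1 := by
    have : (2 : ℝ) • z - u₀ = (2 * ‖z‖ - 1) • u₀ := by
      rw [sub_smul, mul_smul, ← hzu, one_smul]
    rw [this, norm_smul, hu₀, mul_one, Real.norm_eq_abs, abs_le]
    constructor <;> linarith [norm_nonneg z]
  have h2 : 1 ≤ ‖(2 : ℝ) • z - -u₀‖ := by
    have : (2 : ℝ) • z - -u₀ = (2 * ‖z‖ + 1) • u₀ := by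
      rw [add_smul, mul_smul, ← hzu, one_smul, sub_neg_eq_add]
    rw [this, norm_smul, hu₀, mul_one, Real.norm_eq_abs]
    exact le_trans (by linarith [norm_nonneg z]) (le_abs_self _)
  obtain ⟨u, hu, hu'⟩ := himg ⟨h1, h2⟩
  refine ⟨u, (2 : ℝ) • z - u, by simpa using hu, hu', ?_⟩
  rw [add_sub_cancel, smul_smul]
  norm_num

namespace SchauderBasis

variable {X : Type*} [NormedAddCommGroup X] [NormedSpace ℝ X]

/-- The vectors supported in the interval `[m, n)`. -/
noncomputable def block (b : SchauderBasis ℝ X) (m n : ℕ) : Submodule ℝ X :=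
  LinearMap.eqLocus LinearMap.id
    (GeneralSchauderBasis.proj b (Finset.Ico m n) : X →ₗ[ℝ] X)

theorem mem_block {b : SchauderBasis ℝ X} {m n : ℕ} {x : X} :
    x ∈ b.block m n ↔ x = ∑ i ∈ Finset.Ico m n, b.coord i x • b i := by
  simp [block, LinearMap.mem_eqLocus]

theorem basis_mem_block {b : SchauderBasis ℝ X} {m n i : ℕ} (hm : m ≤ i) (hn : i < n) :
    b i ∈ b.block m n := by
  rw [mem_block]
  simp [coord_basis, hm, hn]

theorem proj_mem_block {b : SchauderBasis ℝ X} {m n : ℕ} (hmn : m ≤ n) {x : X}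
    (hx : ∀ i < m, b.coord i x = 0) : proj b n x ∈ b.block m n := by
  have h : proj b n x = ∑ i ∈ Finset.Ico m n, b.coord i x • b i := by
    rw [proj_apply, Finset.sum_Ico_eq_sub _ hmn, eq_comm, sub_eq_self]
    exact Finset.sum_eq_zero fun i hi => by rw [hx i (Finset.mem_range.1 hi), zero_smul]
  rw [h]
  exact Submodule.sum_mem _ fun i hi => Submodule.smul_mem _ _
    (basis_mem_block (Finset.mem_Ico.1 hi).1 (Finset.mem_Ico.1 hi).2)

theorem one_lt_rank_block {b : SchauderBasis ℝ X} {m n : ℕ} (h : m + 2 ≤ n) :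
    1 < Module.rank ℝ (b.block m n) := by
  let v : Fin 2 → b.block m n := fun i =>
    ⟨b (m + i), basis_mem_block (by omega) (by omega)⟩
  have hv : LinearIndependent ℝ v := by
    refine LinearIndependent.of_comp (b.block m n).subtype ?_
    exact b.linearIndependent.comp (fun i : Fin 2 => m + (i : ℕ))
      (fun i j hij => Fin.ext (by simpa using hij))
  have := hv.cardinal_lift_le_rank
  simp only [Cardinal.mk_fin, Cardinal.lift_natCast, Cardinal.lift_id'] at this
  refine lt_of_lt_of_le ?_ this
  exact_mod_cast Nat.one_lt_two

theorem exists_unit_midpoint_block {b : SchauderBasis ℝ X} {m n : ℕ} (h : m + 2 ≤ n) {z : X}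
    (hzb : z ∈ b.block m n) (hz : ‖z‖ ≤ 1) :
    ∃ u ∈ b.block m n, ∃ v ∈ b.block m n, ‖u‖ = 1 ∧ ‖v‖ = 1 ∧ z = (1 / 2 : ℝ) • (u + v) := by
  obtain ⟨u, v, hu, hv, huv⟩ :=
    exists_unit_midpoint (one_lt_rank_block (b := b) h) (z := ⟨z, hzb⟩) hz
  exact ⟨u, u.2, v, v.2, hu, hv, congrArg Subtype.val huv⟩

end SchauderBasis

section Arrays

variable {X : ℕ → Type*} [∀ k, NormedAddCommGroup (X k)] [∀ k, NormedSpace ℝ (X k)]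

/-- A functional that is not small on tails is large on some element whose components are
normalized blocks. -/
theorem exists_normalized_block_element (e : ∀ k, SchauderBasis ℝ (X k))
    (F : StrongDual ℝ (lp X ∞)) {ε : ℝ} (hε : 0 < ε) {z : lp X ∞} {thr : ℕ → ℕ}
    (hz : ∀ k, ∀ i < thr k, (e k).coord i (z k) = 0) (hF : ε * ‖z‖ < |F z|) :
    ∃ (thr' : ℕ → ℕ) (u : lp X ∞), (∀ k, thr k < thr' k) ∧ (∀ k, ‖u k‖ = 1) ∧
      (∀ k, u k ∈ (e k).block (thr k) (thr' k)) ∧ ε < F u := by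
  -- `τ` is the truncation error; the strict inequality leaves room both for the change of `F` and
  -- for the enlargement of the norm bound to `‖z‖ + τ`.
  obtain ⟨τ, hτ, hτF⟩ : ∃ τ > 0, τ * (‖F‖ + ε) < |F z| - ε * ‖z‖ := by
    have hpos : 0 < ‖F‖ + ε := by positivity
    refine ⟨(|F z| - ε * ‖z‖) / (2 * (‖F‖ + ε)), div_pos (by linarith) (by positivity), ?_⟩
    have : (|F z| - ε * ‖z‖) / (2 * (‖F‖ + ε)) * (‖F‖ + ε) = (|F z| - ε * ‖z‖) / 2 := by
      field_simp
    rw [this]; linarith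
  -- The `+ 2` makes each block space at least two-dimensional, as the midpoint lemma demands. That
  -- lemma is needed because curvedness speaks only of blocks of norm exactly one in every summand,
  -- whereas the components of `z` may be short.
  have hN : ∀ k, ∃ N, thr k + 2 ≤ N ∧ ‖z k - SchauderBasis.proj (e k) N (z k)‖ ≤ τ := fun k => by
    have h1 := (Metric.tendsto_nhds.1 (SchauderBasis.tendsto_proj (e k) (z k))) τ hτ
    obtain ⟨N, hN, hN'⟩ := (h1.and (eventually_ge_atTop (thr k + 2))).exists
    exact ⟨N, hN', by rw [dist_comm, dist_eq_norm] at hN; exact hN.le⟩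
  choose N hN hNτ using hN
  have hyb : ∀ k, ‖SchauderBasis.proj (e k) (N k) (z k)‖ ≤ ‖z‖ + τ := fun k => by
    have h1 := lp.norm_apply_le_norm ENNReal.top_ne_zero z k
    have h2 := norm_sub_le (z k) (z k - SchauderBasis.proj (e k) (N k) (z k))
    rw [sub_sub_cancel] at h2
    linarith [hNτ k]
  let y : lp X ∞ := ⟨fun k => SchauderBasis.proj (e k) (N k) (z k), memℓp_infty ⟨‖z‖ + τ, by
    rintro _ ⟨k, rfl⟩; exact hyb k⟩⟩
  have hyk : ∀ k, y k = SchauderBasis.proj (e k) (N k) (z k) := fun k => rfl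
  have hzy : ‖z - y‖ ≤ τ := lp.norm_le_of_forall_le hτ.le hNτ
  have hs : 0 < ‖z‖ + τ := by positivity
  have hFy : ε * (‖z‖ + τ) < |F y| := by
    have h1 : |F (z - y)| ≤ ‖F‖ * τ := (F.le_opNorm _).trans (by gcongr)
    have h2 := abs_add_le (F (z - y)) (F y)
    rw [← map_add, sub_add_cancel] at h2
    nlinarith
  have huv : ∀ k, ∃ u ∈ (e k).block (thr k) (N k), ∃ v ∈ (e k).block (thr k) (N k),
      ‖u‖ = 1 ∧ ‖v‖ = 1 ∧ (‖z‖ + τ)⁻¹ • y k = (1 / 2 : ℝ) • (u + v) := fun k => by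
    refine SchauderBasis.exists_unit_midpoint_block (hN k)
      (Submodule.smul_mem _ _ (SchauderBasis.proj_mem_block (by have := hN k; omega) (hz k))) ?_
    rw [norm_smul, norm_inv, Real.norm_of_nonneg hs.le, inv_mul_le_one₀ hs]
    exact hyb k
  choose u hu v hv hu1 hv1 huv using huv
  let U : lp X ∞ := ⟨u, memℓp_infty ⟨1, by rintro _ ⟨k, rfl⟩; exact (hu1 k).le⟩⟩
  let V : lp X ∞ := ⟨v, memℓp_infty ⟨1, by rintro _ ⟨k, rfl⟩; exact (hv1 k).le⟩⟩
  have hUV : (‖z‖ + τ)⁻¹ • y = (1 / 2 : ℝ) • (U + V) := lp.ext (funext huv)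
  have hlt : ∀ k, thr k < N k := fun k => by have := hN k; omega
  have hFU : ε < (1 / 2) * (|F U| + |F V|) := by
    have h1 : ε < |F ((‖z‖ + τ)⁻¹ • y)| := by
      rw [map_smul, smul_eq_mul, abs_mul, abs_of_pos (inv_pos.2 hs), ← div_eq_inv_mul,
        lt_div_iff₀ hs]
      exact hFy
    rw [hUV, map_smul, map_add, smul_eq_mul, abs_mul, abs_of_pos (by norm_num : (0 : ℝ) < 1 / 2)]
      at h1
    exact h1.trans_le (by gcongr; exact abs_add_le _ _)
  have hneg : ∀ W : lp X ∞, (∀ k, ‖W k‖ = 1) → (∀ k, W k ∈ (e k).block (thr k) (N k)) →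
      ε < |F W| → ∃ u : lp X ∞, (∀ k, ‖u k‖ = 1) ∧
      (∀ k, u k ∈ (e k).block (thr k) (N k)) ∧ ε < F u := fun W h1 h2 h3 => by
    rcases lt_abs.1 h3 with h | h
    · exact ⟨W, h1, h2, h⟩
    · exact ⟨-W, fun k => by rw [lp.coeFn_neg, Pi.neg_apply, norm_neg, h1], fun k => by
        rw [lp.coeFn_neg, Pi.neg_apply]; exact neg_mem (h2 k), by rwa [map_neg]⟩
  have : ε < |F U| ∨ ε < |F V| := by
    by_contra! hcon
    linarith [hcon.1, hcon.2]
  rcases this with h | h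
  · obtain ⟨w, hw⟩ := hneg U hu1 hu h
    exact ⟨N, w, hlt, hw⟩
  · obtain ⟨w, hw⟩ := hneg V hv1 hv h
    exact ⟨N, w, hlt, hw⟩

/-- Every functional on the `ℓ^∞`-sum of a uniformly asymptotically curved array is small on
sufficiently late tails. -/
theorem UniformlyAsymptoticallyCurved.exists_tail_bound {e : ∀ k, SchauderBasis ℝ (X k)}
    (curved : UniformlyAsymptoticallyCurved e) (F : StrongDual ℝ (lp X ∞)) {ε : ℝ} (hε : 0 < ε) :
    ∃ thr : ℕ → ℕ, ∀ z : lp X ∞, (∀ k, ∀ i < thr k, (e k).coord i (z k) = 0) →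
      |F z| ≤ ε * ‖z‖ := by
  by_contra! H
  have step : ∀ thr : ℕ → ℕ, ∃ (thr' : ℕ → ℕ) (u : lp X ∞), (∀ k, thr k < thr' k) ∧
      (∀ k, ‖u k‖ = 1) ∧ (∀ k, u k ∈ (e k).block (thr k) (thr' k)) ∧ ε < F u := fun thr => by
    obtain ⟨z, hz, hF⟩ := H thr
    exact exists_normalized_block_element e F hε hz hF
  choose next u hlt hu1 hub hF using step
  let p : ℕ → ℕ → ℕ := fun j => next^[j] 0
  have hp : ∀ j, p (j + 1) = next (p j) := fun j => Function.iterate_succ_apply' _ _ _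
  -- A block basis needs one coefficient sequence: the coefficient at `i` is read off the block
  -- containing `i`. Since `j ≤ p j k`, searching the block index up to `i` suffices.
  have hlim := curved (fun k j => u (p j) k) fun k => ⟨fun j => hu1 _ k, fun j => p j k,
    fun i => (e k).coord i (u (p (Nat.findGreatest (fun j => p j k ≤ i) i)) k), ?_, ?_⟩
  · have hle : ∀ᶠ n : ℕ in atTop, ε ≤ ‖F‖ *
        ⨆ k : ℕ, ‖(1 / (n : ℝ)) • ∑ j ∈ Finset.range n, u (p j) k‖ := by
      filter_upwards [eventually_gt_atTop 0] with n hn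
      have hn' : (0 : ℝ) < n := Nat.cast_pos.2 hn
      have e1 : (⨆ k : ℕ, ‖(1 / (n : ℝ)) • ∑ j ∈ Finset.range n, u (p j) k‖) =
          ‖(1 / (n : ℝ)) • ∑ j ∈ Finset.range n, u (p j)‖ := by
        rw [lp.norm_eq_ciSup]
        simp only [lp.coeFn_smul, lp.coeFn_sum, Pi.smul_apply, Finset.sum_apply]
      rw [e1]
      refine le_trans ?_ ((Real.le_norm_self _).trans (F.le_opNorm _))
      rw [map_smul, map_sum, smul_eq_mul, one_div, ← div_eq_inv_mul, le_div_iff₀ hn']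
      calc ε * n = ∑ j ∈ Finset.range n, ε := by simp [mul_comm]
        _ ≤ _ := Finset.sum_le_sum fun j _ => (hF _).le
    have h0 := hlim.const_mul ‖F‖
    rw [mul_zero] at h0
    exact absurd (ge_of_tendsto h0 hle) (not_le.2 hε)
  · exact strictMono_nat_of_lt_succ fun j => by rw [hp]; exact hlt _ k
  · intro j
    have hmono : StrictMono fun j => p j k :=
      strictMono_nat_of_lt_succ fun j => by rw [hp]; exact hlt _ k
    have hb := SchauderBasis.mem_block.1 (hub (p j) k)
    rw [← hp] at hb
    refine hb.trans (Finset.sum_congr rfl fun i hi => ?_)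
    obtain ⟨h1, h2⟩ := Finset.mem_Ico.1 hi
    have : Nat.findGreatest (fun j => p j k ≤ i) i = j := by
      rw [Nat.findGreatest_eq_iff]
      refine ⟨(hmono.id_le j).trans h1, fun _ => h1, fun n hn _ hn2 => ?_⟩
      have := hmono.monotone (Nat.succ_le_of_lt hn)
      have h3 : i < p (j + 1) k := h2
      have h4 : p (j + 1) k ≤ p n k := this
      have h5 : p n k ≤ i := hn2
      omega
    exact congrArg (fun m => (e k).coord i (u (p m) k) • e k i) this.symm

end Arrays

/-! ### One turn of the game, from the side of Player I. -/

/-- Under independent random signs the double sum has the diagonal sum as its mean. The induction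
derandomizes this: each new sign is chosen to make its cross terms nonnegative. -/
theorem exists_signs_sum_diag_le (a : ℕ → ℕ → ℝ) (E : Finset ℕ) :
    ∃ ε : ℕ → ℤˣ, ∑ i ∈ E, a i i ≤
      ∑ i ∈ E, ∑ l ∈ E, (((ε i : ℤ) : ℝ) * ((ε l : ℤ) : ℝ)) * a i l := by
  induction E using Finset.induction_on with
  | empty => exact ⟨1, by simp⟩
  | insert x E hx ih =>
    obtain ⟨ε, hε⟩ := ih
    let s : ℝ := ∑ l ∈ E, ((ε l : ℤ) : ℝ) * (a x l + a l x)
    obtain ⟨θ, hθ⟩ : ∃ θ : ℤˣ, 0 ≤ ((θ : ℤ) : ℝ) * s := by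
      rcases le_total 0 s with h | h
      · exact ⟨1, by simpa using h⟩
      · exact ⟨-1, by simpa using h⟩
    refine ⟨Function.update ε x θ, ?_⟩
    have hu : ∀ i ∈ E, Function.update ε x θ i = ε i := fun i hi =>
      Function.update_of_ne (ne_of_mem_of_not_mem hi hx) _ _
    have hθθ : ((θ : ℤ) : ℝ) * ((θ : ℤ) : ℝ) = 1 := by
      exact_mod_cast Int.units_coe_mul_self θ
    have e1 : ∀ i ∈ E, ∑ l ∈ E, (((Function.update ε x θ i : ℤˣ) : ℤ) : ℝ) *
        (((Function.update ε x θ l : ℤˣ) : ℤ) : ℝ) * a i l =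
        ∑ l ∈ E, (((ε i : ℤ) : ℝ) * ((ε l : ℤ) : ℝ)) * a i l := fun i hi =>
      Finset.sum_congr rfl fun l hl => by rw [hu i hi, hu l hl]
    have e2 : ∑ l ∈ E, (((Function.update ε x θ x : ℤˣ) : ℤ) : ℝ) *
        (((Function.update ε x θ l : ℤˣ) : ℤ) : ℝ) * a x l =
        ∑ l ∈ E, ((θ : ℤ) : ℝ) * (((ε l : ℤ) : ℝ) * a x l) :=
      Finset.sum_congr rfl fun l hl => by rw [hu l hl, Function.update_self]; ring
    have e3 : ∑ i ∈ E, (((Function.update ε x θ i : ℤˣ) : ℤ) : ℝ) *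
        (((Function.update ε x θ x : ℤˣ) : ℤ) : ℝ) * a i x =
        ∑ l ∈ E, ((θ : ℤ) : ℝ) * (((ε l : ℤ) : ℝ) * a l x) :=
      Finset.sum_congr rfl fun l hl => by rw [hu l hl, Function.update_self]; ring
    have e4 : ((θ : ℤ) : ℝ) * s = ∑ l ∈ E, ((θ : ℤ) : ℝ) * (((ε l : ℤ) : ℝ) * a x l) +
        ∑ l ∈ E, ((θ : ℤ) : ℝ) * (((ε l : ℤ) : ℝ) * a l x) := by
      rw [← Finset.sum_add_distrib, Finset.mul_sum]
      exact Finset.sum_congr rfl fun l _ => by ring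
    rw [Finset.sum_insert hx, Finset.sum_insert hx]
    simp only [Finset.sum_insert hx, Finset.sum_add_distrib]
    rw [Finset.sum_congr rfl e1, e2, e3, Function.update_self, hθθ, one_mul]
    linarith

section SingleSpace

variable {X : Type*} [NormedAddCommGroup X] [NormedSpace ℝ X]

theorem repFunctional_apply_repVector (b : SchauderBasis ℝ X) (Φ : X →L[ℝ] X) {c : ℕ → Fin 2}
    {η : ℝ} (r : RepMoveII c η) (ε : ℕ → ℤˣ) :
    repFunctional b r ε (Φ (repVector b r ε)) = ∑ i ∈ r.E, ∑ l ∈ r.E,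
      (((ε i : ℤ) : ℝ) * ((ε l : ℤ) : ℝ)) * (r.mu i * r.lam l * b.coord i (Φ (b l))) := by
  rw [repFunctional, repVector, sum_apply]
  refine Finset.sum_congr rfl fun i _ => ?_
  rw [smul_apply, map_sum, map_sum, smul_eq_mul, Finset.mul_sum]
  refine Finset.sum_congr rfl fun l _ => ?_
  rw [map_smul, map_smul, smul_eq_mul]
  ring

/-- The partition of the indices by the sign of the diagonal entries of an operator. -/
noncomputable def diagonalSign (b : SchauderBasis ℝ X) (Φ : X →L[ℝ] X) (i : ℕ) : Fin 2 :=
  open Classical in if 0 ≤ b.coord i (Φ (b i)) then 0 else 1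

/-- If Player I partitions by the sign of the diagonal, then some choice of signs makes the new
diagonal entry large. -/
theorem exists_signs_le_abs_repFunctional (b : SchauderBasis ℝ X) (Φ : X →L[ℝ] X) {δ η : ℝ}
    (hδ0 : 0 ≤ δ) (hδ : ∀ i, δ ≤ |b.coord i (Φ (b i))|) (r : RepMoveII (diagonalSign b Φ) η) :
    ∃ ε : ℕ → ℤˣ, (1 - η) * δ ≤ |repFunctional b r ε (Φ (repVector b r ε))| := by
  have hsum : (1 - η) * δ ≤ ∑ i ∈ r.E, r.mu i * r.lam i * |b.coord i (Φ (b i))| := by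
    calc (1 - η) * δ ≤ (∑ i ∈ r.E, r.lam i * r.mu i) * δ := by gcongr; exact r.lt_sum.le
      _ = ∑ i ∈ r.E, r.mu i * r.lam i * δ := by
        rw [Finset.sum_mul]; exact Finset.sum_congr rfl fun i _ => by ring
      _ ≤ _ := Finset.sum_le_sum fun i hi => mul_le_mul_of_nonneg_left (hδ i)
        (mul_nonneg (r.mu_nonneg i hi) (r.lam_nonneg i hi))
  -- Player II must stay within one piece of the partition, so the diagonal entries involved share a
  -- sign `s` and cannot cancel.
  obtain ⟨s, hs1, hs⟩ : ∃ s : ℝ, |s| = 1 ∧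
      ∀ i ∈ r.E, s * b.coord i (Φ (b i)) = |b.coord i (Φ (b i))| := by
    by_cases hp : r.piece = 0
    · refine ⟨1, abs_one, fun i hi => ?_⟩
      have h := (r.E_subset i hi).trans hp
      have h0 : 0 ≤ b.coord i (Φ (b i)) := by
        by_contra hcon
        simp [diagonalSign, hcon] at h
      rw [one_mul, abs_of_nonneg h0]
    · refine ⟨-1, by simp, fun i hi => ?_⟩
      have h := r.E_subset i hi
      have h0 : ¬ 0 ≤ b.coord i (Φ (b i)) := fun hcon => by
        simp only [diagonalSign, hcon, if_true] at h
        exact hp h.symm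
      rw [abs_of_neg (not_le.1 h0), neg_one_mul]
  obtain ⟨ε, hε⟩ := exists_signs_sum_diag_le
    (fun i l => s * (r.mu i * r.lam l * b.coord i (Φ (b l)))) r.E
  refine ⟨ε, ?_⟩
  calc (1 - η) * δ ≤ _ := hsum
    _ = ∑ i ∈ r.E, s * (r.mu i * r.lam i * b.coord i (Φ (b i))) :=
      Finset.sum_congr rfl fun i hi => by rw [← hs i hi]; ring
    _ ≤ _ := hε
    _ = s * repFunctional b r ε (Φ (repVector b r ε)) := by
      rw [repFunctional_apply_repVector, Finset.mul_sum]
      refine Finset.sum_congr rfl fun i _ => ?_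
      rw [Finset.mul_sum]
      exact Finset.sum_congr rfl fun l _ => by ring
    _ ≤ |s * repFunctional b r ε (Φ (repVector b r ε))| := le_abs_self _
    _ = _ := by rw [abs_mul, hs1, one_mul]

/-- Player I can force the vector to be close to a tail and the functional to nearly annihilate a
given finite set. -/
theorem exists_repMoveI (b : SchauderBasis ℝ X) {α : ℝ} (hα : 0 < α) (t : ℕ) (S : Finset X) :
    ∃ p : RepMoveI X, p.eta = α ∧ (∀ w ∈ p.W, ∀ i < t, b.coord i w = 0) ∧
      ∀ g ∈ p.G, ∀ v ∈ S, g v = 0 := by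
  let φ : X →ₗ[ℝ] (Fin t → ℝ) := LinearMap.pi fun i => (b.coord i : X →ₗ[ℝ] ℝ)
  let ψ : StrongDual ℝ X →ₗ[ℝ] (S → ℝ) :=
    LinearMap.pi fun v => (ContinuousLinearMap.apply ℝ ℝ (v : X) : StrongDual ℝ X →ₗ[ℝ] ℝ)
  refine ⟨{ eta := α, eta_pos := hα, W := LinearMap.ker φ, W_cofinite := ?_, G := LinearMap.ker ψ,
            G_cofinite := ?_, G_weakStarClosed := ?_ }, rfl, fun w hw i hi => ?_,
            fun g hg v hv => ?_⟩
  · exact φ.quotKerEquivRange.symm.finiteDimensional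
  · exact ψ.quotKerEquivRange.symm.finiteDimensional
  · have : ((WeakDual.toStrongDual (𝕜 := ℝ) (E := X)) ⁻¹'
        ((LinearMap.ker ψ : Submodule ℝ (StrongDual ℝ X)) : Set (StrongDual ℝ X))) =
        ⋂ v : S, {f : WeakDual ℝ X | f (v : X) = 0} := by
      ext f
      simp only [Set.mem_preimage, SetLike.mem_coe, LinearMap.mem_ker, Set.mem_iInter,
        Set.mem_ofPred_eq]
      exact funext_iff
    rw [this]
    exact isClosed_iInter fun v =>
      isClosed_singleton.preimage (WeakDual.eval_continuous (𝕜 := ℝ) (v : X))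
  · exact congrFun (LinearMap.mem_ker.1 hw) ⟨i, hi⟩
  · exact congrFun (LinearMap.mem_ker.1 hg) ⟨v, hv⟩

end SingleSpace

/-! ### Playing all the games simultaneously. -/

/-- Dependent choice along a rank function. -/
theorem exists_dependent_choice {α : Type*} (m : α → ℕ) {C : α → Type*}
    (S : ∀ a, (∀ b, C b) → C a → Prop) [∀ a, Nonempty (C a)] (h : ∀ a g, ∃ c, S a g c) :
    ∃ g : ∀ a, C a, ∀ a, ∃ g' : ∀ b, C b, (∀ b, m b < m a → g' b = g b) ∧ S a g' (g a) := by
  classical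
  -- Values not yet chosen are filled in arbitrarily, so that `S` can be stated for total families;
  -- hence the conclusion only provides some `g'` agreeing with `g` at lower rank.
  let ext : ∀ a, (∀ b, m b < m a → C b) → ∀ b, C b := fun a ih b =>
    if hb : m b < m a then ih b hb else Classical.arbitrary _
  let F : ∀ a, (∀ b, m b < m a → C b) → C a := fun a ih => (h a (ext a ih)).choose
  let g : ∀ a, C a := (measure m).wf.fix F
  refine ⟨g, fun a => ⟨ext a fun b _ => g b, fun b hb => dif_pos hb, ?_⟩⟩
  have : g a = F a fun b _ => g b := (measure m).wf.fix_eq F a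
  rw [this]
  exact (h a (ext a fun b _ => g b)).choose_spec

/-- The record of one turn in the simultaneous play: the moves of Player I, the resulting vector
and functional, and the thresholds to be respected by later turns. -/
structure ArrayTurn (X : Type*) [NormedAddCommGroup X] [NormedSpace ℝ X] where
  move : RepMoveI X
  signs : ℕ → ℤˣ
  vec : X
  func : StrongDual ℝ X
  thr : ℕ → ℕ

section Arrays

variable {X : ℕ → Type*} [∀ k, NormedAddCommGroup (X k)] [∀ k, NormedSpace ℝ (X k)]

/-- The diagonal block of an operator on an `ℓ^∞`-sum. -/
noncomputable def diagonalBlock (T : lp X ∞ →L[ℝ] lp X ∞) (k : ℕ) : X k →L[ℝ] X k :=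
  (lp.evalCLM ℝ X ∞ k).comp (T.comp (lp.singleContinuousLinearMap ℝ X ∞ k))

theorem diagonalBlock_apply (T : lp X ∞ →L[ℝ] lp X ∞) (k : ℕ) (x : X k) :
    diagonalBlock T k x = (T (lp.single ∞ k x) : lp X ∞) k := rfl

instance (k : ℕ) : Nonempty (ArrayTurn (X k)) :=
  ⟨⟨⟨1, one_pos, ⊤, inferInstance, ⊤, inferInstance, by simp⟩, 1, 0, 0, 0⟩⟩

/-- Playing the games for all the bases at the same time, in the order given by `Nat.pair`. -/
theorem exists_simultaneous_play {e : ∀ k, SchauderBasis ℝ (X k)}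
    (curved : UniformlyAsymptoticallyCurved e) (T : lp X ∞ →L[ℝ] lp X ∞) {C η δ : ℝ}
    (hδ0 : 0 ≤ δ) (hδ : ∀ k j, δ ≤ |arrayDiagonal e T k j|)
    (hrep : ∀ k, PlayerIIWinsRep (e k) C η) {α : ℕ → ℝ} (hα : ∀ n, 0 < α n) :
    ∃ (x : ∀ k, ℕ → X k) (f : ∀ k, ℕ → StrongDual ℝ (X k)) (thr : ℕ → ℕ → ℕ → ℕ),
      (∀ k, ImpartiallyEquivalent (C + η) (x k) (fun n => e k n)) ∧
      (∀ k, ImpartiallyEquivalent (C + η) (f k) (fun n => (e k).coord n)) ∧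
      (∀ k j, (1 - η) * δ ≤ |f k j ((T (lp.single ∞ k (x k j)) : lp X ∞) k)|) ∧
      (∀ k j k' j', Nat.pair k' j' < Nat.pair k j →
        |f k j ((T (lp.single ∞ k' (x k' j')) : lp X ∞) k)| ≤
          α (Nat.pair k j) * ‖T (lp.single ∞ k' (x k' j'))‖) ∧
      (∀ k j i, i < Nat.pair k j → |f k j (e k i)| ≤ α (Nat.pair k j) * ‖e k i‖) ∧
      (∀ k j, ∃ w, ‖x k j - w‖ ≤ α (Nat.pair k j) ∧
        ∀ k' j', Nat.pair k' j' < Nat.pair k j → ∀ i < thr k' j' k, (e k).coord i w = 0) ∧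
      (∀ k j (z : lp X ∞), (∀ k', ∀ i < thr k j k', (e k').coord i (z k') = 0) →
        |f k j ((T z : lp X ∞) k)| ≤ α (Nat.pair k j) * ‖z‖) := by
  classical
  choose σ hσ using fun k => hrep k (diagonalSign (e k) (diagonalBlock T k))
  -- The answer of the strategy to a candidate move `p`: the moves of earlier turns come from the
  -- history, and `p` fills the last slot.
  let r : ∀ a : ℕ × ℕ, (∀ b : ℕ × ℕ, ArrayTurn (X b.1)) → RepMoveI (X a.1) →
      RepMoveII (diagonalSign (e a.1) (diagonalBlock T a.1)) η := fun a h p =>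
    σ a.1 a.2 (fun i : Fin (a.2 + 1) => if (i : ℕ) < a.2 then (h (a.1, (i : ℕ))).move else p)
      (fun i : Fin a.2 => (h (a.1, (i : ℕ))).signs)
  let S : ∀ a : ℕ × ℕ, (∀ b : ℕ × ℕ, ArrayTurn (X b.1)) → ArrayTurn (X a.1) → Prop :=
    fun a h c =>
      c.move.eta = α (Nat.pair a.1 a.2) ∧
      (∀ w ∈ c.move.W, ∀ b : ℕ × ℕ, Nat.pair b.1 b.2 < Nat.pair a.1 a.2 →
        ∀ i < (h b).thr a.1, (e a.1).coord i w = 0) ∧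
      (∀ g ∈ c.move.G, (∀ b : ℕ × ℕ, Nat.pair b.1 b.2 < Nat.pair a.1 a.2 →
        g ((T (lp.single ∞ b.1 (h b).vec) : lp X ∞) a.1) = 0) ∧
        ∀ i < Nat.pair a.1 a.2, g (e a.1 i) = 0) ∧
      c.vec = repVector (e a.1) (r a h c.move) c.signs ∧
      c.func = repFunctional (e a.1) (r a h c.move) c.signs ∧
      (1 - η) * δ ≤ |c.func (diagonalBlock T a.1 c.vec)| ∧
      ∀ z : lp X ∞, (∀ k', ∀ i < c.thr k', (e k').coord i (z k') = 0) →
        |c.func ((T z : lp X ∞) a.1)| ≤ α (Nat.pair a.1 a.2) * ‖z‖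
  have hS : ∀ a h, ∃ c, S a h c := by
    intro a h
    obtain ⟨p, hp, hW, hG⟩ := exists_repMoveI (e a.1) (hα (Nat.pair a.1 a.2))
      ((Finset.range (Nat.pair a.1 a.2)).sup fun m => (h (Nat.unpair m)).thr a.1)
      ((Finset.range (Nat.pair a.1 a.2)).image (fun m =>
        (T (lp.single ∞ (Nat.unpair m).1 (h (Nat.unpair m)).vec) : lp X ∞) a.1) ∪
        (Finset.range (Nat.pair a.1 a.2)).image (e a.1))
    -- The signs come after Player II's answer, and the thresholds after the signs, because they
    -- depend on the resulting functional.
    obtain ⟨ε, hε⟩ := exists_signs_le_abs_repFunctional (e a.1) (diagonalBlock T a.1) hδ0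
      (hδ a.1) (r a h p)
    obtain ⟨thr, hthr⟩ := curved.exists_tail_bound
      ((repFunctional (e a.1) (r a h p) ε).comp ((lp.evalCLM ℝ X ∞ a.1).comp T))
      (hα (Nat.pair a.1 a.2))
    refine ⟨⟨p, ε, _, _, thr⟩, hp, fun w hw b hb i hi => hW w hw i (hi.trans_le ?_),
      fun g hg => ⟨fun b hb => hG g hg _ ?_, fun i hi => hG g hg _ ?_⟩, rfl, rfl, hε, hthr⟩
    · have := Finset.le_sup (f := fun m => (h (Nat.unpair m)).thr a.1) (Finset.mem_range.2 hb)
      rwa [Nat.unpair_pair] at this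
    · refine Finset.mem_union_left _ (Finset.mem_image.2 ⟨_, Finset.mem_range.2 hb, ?_⟩)
      rw [Nat.unpair_pair]
    · exact Finset.mem_union_right _ (Finset.mem_image_of_mem _ (Finset.mem_range.2 hi))
  obtain ⟨g, hg⟩ := exists_dependent_choice (fun a : ℕ × ℕ => Nat.pair a.1 a.2) S hS
  -- The strategy consults only turns `(k, i)` with `i < j`, which precede `(k, j)` in the pairing
  -- order. Hence the constructed turns form a genuine run of each game.
  have hr : ∀ (a : ℕ × ℕ) (h : ∀ b : ℕ × ℕ, ArrayTurn (X b.1)),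
      (∀ b : ℕ × ℕ, Nat.pair b.1 b.2 < Nat.pair a.1 a.2 → h b = g b) →
      r a h (g a).move = σ a.1 a.2 (fun i => (g (a.1, (i : ℕ))).move)
        (fun i => (g (a.1, (i : ℕ))).signs) := by
    rintro ⟨k, j⟩ h hh
    have e1 : (fun i : Fin (j + 1) => if (i : ℕ) < j then (h (k, (i : ℕ))).move else
        (g (k, j)).move) = fun i : Fin (j + 1) => (g (k, (i : ℕ))).move := by
      funext i
      by_cases hi : (i : ℕ) < j
      · rw [if_pos hi, hh (k, (i : ℕ)) (Nat.pair_lt_pair_right k hi)]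
      · have : (i : ℕ) = j := by omega
        rw [if_neg hi, this]
    have e2 : (fun i : Fin j => (h (k, (i : ℕ))).signs) = fun i : Fin j => (g (k, (i : ℕ))).signs := by
      funext i
      rw [hh (k, (i : ℕ)) (Nat.pair_lt_pair_right k i.2)]
    change σ k j _ _ = _
    rw [e1, e2]
  have hwon := fun k => hσ k (fun j => (g (k, j)).move) (fun j => (g (k, j)).signs)
  have hvec : ∀ k j, repVector (e k) (σ k j (fun i => (g (k, (i : ℕ))).move)
      (fun i => (g (k, (i : ℕ))).signs)) (g (k, j)).signs = (g (k, j)).vec := fun k j => by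
    obtain ⟨h, hh, hS⟩ := hg (k, j)
    rw [hS.2.2.2.1, hr (k, j) h hh]
  have hfunc : ∀ k j, repFunctional (e k) (σ k j (fun i => (g (k, (i : ℕ))).move)
      (fun i => (g (k, (i : ℕ))).signs)) (g (k, j)).signs = (g (k, j)).func := fun k j => by
    obtain ⟨h, hh, hS⟩ := hg (k, j)
    rw [hS.2.2.2.2.1, hr (k, j) h hh]
  simp only [RepWon, hvec, hfunc] at hwon
  have hnear : ∀ k j, ∃ φ ∈ (g (k, j)).move.G,
      ‖(g (k, j)).func - φ‖ < α (Nat.pair k j) := fun k j => by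
    obtain ⟨h, hh, hS⟩ := hg (k, j)
    have := (hwon k).2.2.2 j
    rw [hS.1, Metric.infDist_lt_iff ⟨0, (g (k, j)).move.G.zero_mem⟩] at this
    simpa only [dist_eq_norm, SetLike.mem_coe] using this
  refine ⟨fun k j => (g (k, j)).vec, fun k j => (g (k, j)).func, fun k j => (g (k, j)).thr,
    fun k => (hwon k).1, fun k => (hwon k).2.1, fun k j => ?_, fun k j k' j' hlt => ?_,
    fun k j i hi => ?_, fun k j => ?_, fun k j z hz => ?_⟩
  · obtain ⟨h, hh, hS⟩ := hg (k, j)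
    exact hS.2.2.2.2.2.1
  · obtain ⟨h, hh, hS⟩ := hg (k, j)
    obtain ⟨φ, hφ, hd⟩ := hnear k j
    have h0 := (hS.2.2.1 φ hφ).1 (k', j') hlt
    rw [hh (k', j') hlt] at h0
    set v := T (lp.single ∞ k' (g (k', j')).vec)
    have e1 : (g (k, j)).func (v k) = ((g (k, j)).func - φ) (v k) := by
      rw [sub_apply, h0, sub_zero]
    rw [e1]
    exact (((g (k, j)).func - φ).le_opNorm _).trans
      (mul_le_mul hd.le (lp.norm_apply_le_norm ENNReal.top_ne_zero v k) (norm_nonneg _) (hα _).le)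
  · obtain ⟨h, hh, hS⟩ := hg (k, j)
    obtain ⟨φ, hφ, hd⟩ := hnear k j
    have h0 := (hS.2.2.1 φ hφ).2 i hi
    have e1 : (g (k, j)).func (e k i) = ((g (k, j)).func - φ) (e k i) := by
      rw [sub_apply, h0, sub_zero]
    rw [e1]
    exact ((g (k, j)).func - φ).le_of_opNorm_le hd.le _
  · obtain ⟨h, hh, hS⟩ := hg (k, j)
    have := (hwon k).2.2.1 j
    rw [hS.1, Metric.infDist_lt_iff ⟨0, (g (k, j)).move.W.zero_mem⟩] at this
    obtain ⟨w, hw, hd⟩ := this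
    rw [dist_eq_norm] at hd
    refine ⟨w, hd.le, fun k' j' hlt i hi => hS.2.1 w hw (k', j') hlt i ?_⟩
    rwa [hh (k', j') hlt]
  · obtain ⟨h, hh, hS⟩ := hg (k, j)
    exact hS.2.2.2.2.2.2 z hz

end Arrays

/-! ### Off-diagonal estimates and reduction to a diagonal operator. -/

section Arrays

variable {X : ℕ → Type*} [∀ k, NormedAddCommGroup (X k)] [∀ k, NormedSpace ℝ (X k)]

/-- If `B` maps the basis vectors with indices in `P` close to vectors supported beyond the
thresholds of `φ`, then `φ ∘ B` is small on the elements with coordinates in `P`. -/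
theorem abs_apply_le_of_late [∀ k, CompleteSpace (X k)] {e : ∀ k, SchauderBasis ℝ (X k)}
    (he : ∀ k j, ‖e k j‖ = 1) {lam : ℝ} (hlam : 0 ≤ lam)
    (hproj : ∀ k n, ‖SchauderBasis.proj (e k) n‖ ≤ lam) {x : ∀ k, ℕ → X k}
    {B : lp X ∞ →L[ℝ] lp X ∞} {s : ℝ} (hBs : ‖B‖ ≤ s)
    (hB : ∀ z k, Tendsto (fun n => ∑ j ∈ Finset.range n, (e k).coord j (z k) • x k j) atTop
      (𝓝 ((B z : lp X ∞) k)))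
    (φ : StrongDual ℝ (lp X ∞)) {thr : ℕ → ℕ} {a : ℝ} (ha : 0 ≤ a)
    (hφ : ∀ z : lp X ∞, (∀ k, ∀ i < thr k, (e k).coord i (z k) = 0) → |φ z| ≤ a * ‖z‖)
    (P : ℕ → ℕ → Prop) {w : ∀ k, ℕ → X k} {β : ℕ → ℝ} {b : ℝ} (hβ0 : ∀ j, 0 ≤ β j)
    (hβ : HasSum β b)
    (hw : ∀ k j, P k j → ‖x k j - w k j‖ ≤ β j)
    (hw0 : ∀ k j, P k j → ∀ i < thr k, (e k).coord i (w k j) = 0)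
    {z : lp X ∞} (hz : ∀ k j, ¬ P k j → (e k).coord j (z k) = 0) :
    |φ (B z)| ≤ (a * (s + 2 * lam * b) + ‖φ‖ * (2 * lam * b)) * ‖z‖ := by
  have hb0 : 0 ≤ b := hβ.nonneg hβ0
  have hterm : ∀ k j, ‖(e k).coord j (z k) • (x k j - w k j)‖ ≤ 2 * lam * ‖z‖ * β j := by
    intro k j
    by_cases hP : P k j
    · rw [norm_smul]
      refine mul_le_mul ?_ (hw k j hP) (norm_nonneg _) (by positivity)
      refine (SchauderBasis.abs_coord_le (he k) (hproj k) j (z k)).trans ?_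
      gcongr
      exact lp.norm_apply_le_norm ENNReal.top_ne_zero z k
    · rw [hz k j hP, zero_smul, norm_zero]
      exact mul_nonneg (by positivity) (hβ0 j)
  have hsum := hβ.mul_left (2 * lam * ‖z‖)
  have hys : ∀ k, Summable fun j => (e k).coord j (z k) • (x k j - w k j) := fun k =>
    Summable.of_norm_bounded hsum.summable (hterm k)
  have hyk : ∀ k, ‖∑' j, (e k).coord j (z k) • (x k j - w k j)‖ ≤ 2 * lam * b * ‖z‖ := fun k =>
    (tsum_of_norm_bounded hsum (hterm k)).trans_eq (by ring)
  -- The series for `B z` is only known to converge in each summand, so `φ` cannot be applied term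
  -- by term. Instead, subtracting the small correction `y` puts `B z` exactly beyond the
  -- thresholds, where `hφ` applies.
  let y : lp X ∞ := ⟨fun k => ∑' j, (e k).coord j (z k) • (x k j - w k j),
    memℓp_infty ⟨2 * lam * b * ‖z‖, by rintro _ ⟨k, rfl⟩; exact hyk k⟩⟩
  have hy : ‖y‖ ≤ 2 * lam * b * ‖z‖ := lp.norm_le_of_forall_le (by positivity) hyk
  have hvan : ∀ k, ∀ i < thr k, (e k).coord i ((B z - y : lp X ∞) k) = 0 := fun k i hi => by
    have h1 := (hB z k).sub (hys k).hasSum.tendsto_sum_nat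
    have h2 := (((e k).coord i).continuous.tendsto _).comp h1
    refine tendsto_nhds_unique h2 (tendsto_const_nhds.congr fun n => ?_)
    rw [Function.comp_apply, ← Finset.sum_sub_distrib, map_sum, eq_comm]
    refine Finset.sum_eq_zero fun j _ => ?_
    rw [← smul_sub, sub_sub_cancel, map_smul, smul_eq_mul]
    by_cases hP : P k j
    · rw [hw0 k j hP i hi, mul_zero]
    · rw [hz k j hP, zero_mul]
  have hBz : ‖B z‖ ≤ s * ‖z‖ := B.le_of_opNorm_le hBs z
  have h1 : |φ (B z - y)| ≤ a * ((s + 2 * lam * b) * ‖z‖) := by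
    refine (hφ _ hvan).trans (mul_le_mul_of_nonneg_left ?_ ha)
    exact (norm_sub_le _ _).trans (by linarith)
  have h2 : |φ y| ≤ ‖φ‖ * (2 * lam * b * ‖z‖) := (φ.le_opNorm y).trans (by gcongr)
  have h3 := abs_add_le (φ (B z - y)) (φ y)
  rw [← map_add, sub_add_cancel] at h3
  linarith

/-- The part of `z` whose coordinates come after the first `n` ones in the order of `Nat.pair`. -/
noncomputable def arrayTail (e : ∀ k, SchauderBasis ℝ (X k)) (n : ℕ) (z : lp X ∞) : lp X ∞ :=
  z - ∑ m ∈ Finset.range n, (e m.unpair.1).coord m.unpair.2 (z m.unpair.1) •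
    lp.single ∞ m.unpair.1 (e m.unpair.1 m.unpair.2)

theorem coord_lp_single (e : ∀ k, SchauderBasis ℝ (X k)) (k j k' j' : ℕ) :
    (e k).coord j ((lp.single ∞ k' (e k' j') : lp X ∞) k) =
      if Nat.pair k' j' = Nat.pair k j then 1 else 0 := by
  by_cases hk : k = k'
  · subst hk
    rw [lp.single_apply_self, SchauderBasis.coord_basis]
    simp [Nat.pair_eq_pair, eq_comm]
  · rw [lp.single_apply_ne _ _ _ hk, map_zero, if_neg]
    rw [Nat.pair_eq_pair]
    exact fun h => hk h.1.symm

theorem coord_arrayTail (e : ∀ k, SchauderBasis ℝ (X k)) {n k j : ℕ} (h : Nat.pair k j < n)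
    (z : lp X ∞) : (e k).coord j ((arrayTail e n z) k) = 0 := by
  rw [arrayTail, lp.coeFn_sub, Pi.sub_apply, lp.coeFn_sum, Finset.sum_apply, map_sub, map_sum,
    Finset.sum_eq_single (Nat.pair k j)]
  · rw [lp.coeFn_smul, Pi.smul_apply, map_smul, coord_lp_single, Nat.pair_unpair, if_pos rfl,
      Nat.unpair_pair, smul_eq_mul, mul_one, sub_self]
  · intro m _ hm
    rw [lp.coeFn_smul, Pi.smul_apply, map_smul, coord_lp_single, Nat.pair_unpair, if_neg hm,
      smul_zero]
  · exact fun h' => absurd (Finset.mem_range.2 h) h'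

theorem norm_arrayTail_le {e : ∀ k, SchauderBasis ℝ (X k)}
    (he : ∀ k j, ‖e k j‖ = 1) {lam : ℝ} (hlam : 0 ≤ lam)
    (hproj : ∀ k n, ‖SchauderBasis.proj (e k) n‖ ≤ lam) (n : ℕ) (z : lp X ∞) :
    ‖arrayTail e n z‖ ≤ (1 + n * (2 * lam)) * ‖z‖ := by
  have h : ‖∑ m ∈ Finset.range n, (e m.unpair.1).coord m.unpair.2 (z m.unpair.1) •
      (lp.single ∞ m.unpair.1 (e m.unpair.1 m.unpair.2) : lp X ∞)‖ ≤
      ∑ m ∈ Finset.range n, 2 * lam * ‖z‖ := norm_sum_le_of_le _ fun m _ => by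
    rw [norm_smul, lp.norm_single (by simp), he, mul_one]
    refine (SchauderBasis.abs_coord_le (he _) (hproj _) _ _).trans ?_
    gcongr
    exact lp.norm_apply_le_norm ENNReal.top_ne_zero z _
  rw [Finset.sum_const, Finset.card_range, nsmul_eq_mul] at h
  exact (norm_sub_le _ _).trans (by linarith)

end Arrays

theorem ImpartiallyEquivalent.norm_le {X Y : Type*} [NormedAddCommGroup X] [NormedSpace ℝ X]
    [NormedAddCommGroup Y] [NormedSpace ℝ Y] {C : ℝ} {x : ℕ → X} {y : ℕ → Y}
    (h : ImpartiallyEquivalent C x y) (j : ℕ) : ‖x j‖ ≤ √C * ‖y j‖ := by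
  simpa using (h {j} 1).2

section Arrays

variable {X : ℕ → Type*} [∀ k, NormedAddCommGroup (X k)] [∀ k, NormedSpace ℝ (X k)]

/-- Splitting off finitely many terms avoids any norm-convergent expansion of `z` in the `ℓ^∞`-sum.
-/
theorem apply_eq_arrayTail_add_sum (e : ∀ k, SchauderBasis ℝ (X k)) (n : ℕ) (z : lp X ∞)
    {x : ∀ k, ℕ → X k} {B : lp X ∞ →L[ℝ] lp X ∞}
    (hB : ∀ k j, B (lp.single ∞ k (e k j)) = lp.single ∞ k (x k j)) (φ : StrongDual ℝ (lp X ∞)) :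
    φ (B z) = φ (B (arrayTail e n z)) + ∑ m ∈ Finset.range n,
      (e m.unpair.1).coord m.unpair.2 (z m.unpair.1) *
        φ (lp.single ∞ m.unpair.1 (x m.unpair.1 m.unpair.2)) := by
  have h : z = arrayTail e n z + ∑ m ∈ Finset.range n,
      (e m.unpair.1).coord m.unpair.2 (z m.unpair.1) •
        (lp.single ∞ m.unpair.1 (e m.unpair.1 m.unpair.2) : lp X ∞) := by
    rw [arrayTail, sub_add_cancel]
  conv_lhs => rw [h]
  simp only [map_add, map_sum, map_smul, hB, smul_eq_mul]

/-- Since `1/8 = 1/4 * 1/2`, a single accuracy pays twice: one factor retains decay in the row index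
`n`, the other is summable in `j`. -/
theorem eighth_pow_le {n p j : ℕ} (hn : n ≤ p) (hj : j ≤ p) :
    ((1 : ℝ) / 8) ^ p ≤ (1 / 4) ^ n * (1 / 2) ^ j := by
  have : ((1 : ℝ) / 8) ^ p = (1 / 4) ^ p * (1 / 2) ^ p := by rw [← mul_pow]; norm_num
  rw [this]
  exact mul_le_mul (pow_le_pow_of_le_one (by norm_num) (by norm_num) hn)
    (pow_le_pow_of_le_one (by norm_num) (by norm_num) hj) (by positivity) (by positivity)

/-- The off-diagonal part of a row of the transformed operator is small. -/
theorem abs_row_le [∀ k, CompleteSpace (X k)] {e : ∀ k, SchauderBasis ℝ (X k)}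
    (he : ∀ k j, ‖e k j‖ = 1) {lam : ℝ} (hlam : 1 ≤ lam)
    (hproj : ∀ k n, ‖SchauderBasis.proj (e k) n‖ ≤ lam) {x : ∀ k, ℕ → X k}
    {B : lp X ∞ →L[ℝ] lp X ∞} {s : ℝ} (hs : 0 ≤ s) (hBs : ‖B‖ ≤ s)
    (hB : ∀ z k, Tendsto (fun n => ∑ j ∈ Finset.range n, (e k).coord j (z k) • x k j) atTop
      (𝓝 ((B z : lp X ∞) k)))
    (hBe : ∀ k j, B (lp.single ∞ k (e k j)) = lp.single ∞ k (x k j))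
    {ρ : ℝ} (hρ : 0 ≤ ρ) (hρ1 : ρ ≤ 1) {M N : ℝ} (hN : 0 ≤ N) (φ : StrongDual ℝ (lp X ∞))
    (hφM : ‖φ‖ ≤ M)
    {thr : ℕ → ℕ} {k j : ℕ}
    (hφ : ∀ z : lp X ∞, (∀ k', ∀ i < thr k', (e k').coord i (z k') = 0) →
      |φ z| ≤ ρ * (1 / 8) ^ Nat.pair k j * ‖z‖)
    (hearly : ∀ k' j', Nat.pair k' j' < Nat.pair k j →
      |φ (lp.single ∞ k' (x k' j'))| ≤ ρ * (1 / 8) ^ Nat.pair k j * N)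
    (hlate : ∀ k' j', Nat.pair k j < Nat.pair k' j' →
      ∃ w, ‖x k' j' - w‖ ≤ ρ * (1 / 8) ^ Nat.pair k' j' ∧ ∀ i < thr k', (e k').coord i w = 0)
    (z : lp X ∞) :
    |φ (B z) - φ (lp.single ∞ k (x k j)) * (e k).coord j (z k)| ≤
      ρ * (3 * lam * (s + 4 * lam + 4 * lam * M) + 2 * lam * N) * (1 / 2) ^ j * ‖z‖ := by
  have hlam0 : 0 ≤ lam := by linarith
  have hM : 0 ≤ M := (norm_nonneg _).trans hφM
  set n := Nat.pair k j with hn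
  have hjn : j ≤ n := Nat.right_le_pair k j
  set t := arrayTail e (n + 1) z with ht
  set q : ℝ := ρ * (1 / 4) ^ n with hq
  have hq0 : 0 ≤ q := by positivity
  have hq1 : q ≤ 1 := mul_le_one₀ hρ1 (by positivity) (pow_le_one₀ (by norm_num) (by norm_num))
  have ha0 : 0 ≤ ρ * (1 / 8) ^ n := by positivity
  have haq : ρ * (1 / 8) ^ n ≤ q :=
    mul_le_mul_of_nonneg_left (pow_le_pow_left₀ (by norm_num) (by norm_num) n) hρ
  -- The factor `n + 1` comes from the crude norm bound on the tail and bounds the number of early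
  -- terms; half of the decay of `q` absorbs it.
  have hqn : q * (n + 1) ≤ ρ * (1 / 2) ^ j := by
    have h1 : ((n : ℝ) + 1) ≤ 2 ^ n := by exact_mod_cast Nat.lt_two_pow_self
    have h2 : ((1 : ℝ) / 4) ^ n * 2 ^ n = (1 / 2) ^ n := by rw [← mul_pow]; norm_num
    calc q * (n + 1) ≤ q * 2 ^ n := by gcongr
      _ = ρ * (1 / 2) ^ n := by rw [hq, mul_assoc, h2]
      _ ≤ ρ * (1 / 2) ^ j := mul_le_mul_of_nonneg_left
        (pow_le_pow_of_le_one (by norm_num) (by norm_num) hjn) hρ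
  -- At positions that are not late, `w` is a dummy zero: the coordinates of `t` vanish there.
  have hchoice : ∀ k' j', ∃ w, n < Nat.pair k' j' → ‖x k' j' - w‖ ≤ q * (1 / 2) ^ j' ∧
      ∀ i < thr k', (e k').coord i w = 0 := fun k' j' => by
    by_cases h : n < Nat.pair k' j'
    · obtain ⟨w, hw, hw'⟩ := hlate k' j' h
      refine ⟨w, fun _ => ⟨hw.trans ?_, hw'⟩⟩
      rw [hq, mul_assoc]
      exact mul_le_mul_of_nonneg_left (eighth_pow_le h.le (Nat.right_le_pair k' j')) hρ
    · exact ⟨0, fun h' => absurd h' h⟩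
  choose w hw using hchoice
  have hgeo : HasSum (fun j' : ℕ => q * (1 / 2) ^ j') (q * 2) :=
    hasSum_geometric_two.mul_left q
  have htail := abs_apply_le_of_late he hlam0 hproj hBs hB φ ha0 hφ
    (fun k' j' => n < Nat.pair k' j') (fun j' => by positivity) hgeo
    (fun k' j' h => (hw k' j' h).1) (fun k' j' h => (hw k' j' h).2) (z := t)
    (fun k' j' h => coord_arrayTail e (Nat.lt_succ_of_le (not_lt.1 h)) z)
  have htn : ‖t‖ ≤ (3 * lam) * (n + 1) * ‖z‖ := by
    refine (norm_arrayTail_le he hlam0 hproj (n + 1) z).trans ?_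
    push_cast
    have : (0 : ℝ) ≤ n := n.cast_nonneg
    gcongr
    nlinarith
  have hcoef : ρ * (1 / 8) ^ n * (s + 2 * lam * (q * 2)) + ‖φ‖ * (2 * lam * (q * 2)) ≤
      q * (s + 4 * lam + 4 * lam * M) := by
    have h1 : ρ * (1 / 8) ^ n * (s + 2 * lam * (q * 2)) ≤ q * (s + 4 * lam) := by
      refine mul_le_mul haq ?_ (by positivity) hq0
      nlinarith
    have h2 : ‖φ‖ * (2 * lam * (q * 2)) ≤ M * (2 * lam * (q * 2)) := by gcongr
    nlinarith
  have hT : |φ (B t)| ≤ 3 * lam * (s + 4 * lam + 4 * lam * M) * (ρ * (1 / 2) ^ j) * ‖z‖ := by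
    calc |φ (B t)| ≤ _ := htail
      _ ≤ q * (s + 4 * lam + 4 * lam * M) * ((3 * lam) * (n + 1) * ‖z‖) := by gcongr
      _ = 3 * lam * (s + 4 * lam + 4 * lam * M) * (q * (n + 1)) * ‖z‖ := by ring
      _ ≤ _ := by gcongr
  have hE : |∑ m ∈ Finset.range n, (e m.unpair.1).coord m.unpair.2 (z m.unpair.1) *
        φ (lp.single ∞ m.unpair.1 (x m.unpair.1 m.unpair.2))| ≤
      2 * lam * N * (ρ * (1 / 2) ^ j) * ‖z‖ := by
    have h1 : |∑ m ∈ Finset.range n, (e m.unpair.1).coord m.unpair.2 (z m.unpair.1) *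
        φ (lp.single ∞ m.unpair.1 (x m.unpair.1 m.unpair.2))| ≤
        ∑ m ∈ Finset.range n, (2 * lam * ‖z‖) * (q * N) := by
      refine (Finset.abs_sum_le_sum_abs _ _).trans (Finset.sum_le_sum fun m hm => ?_)
      rw [abs_mul]
      refine mul_le_mul ?_ ?_ (abs_nonneg _) (by positivity)
      · refine (SchauderBasis.abs_coord_le (he _) (hproj _) _ _).trans ?_
        gcongr
        exact lp.norm_apply_le_norm ENNReal.top_ne_zero z _
      · refine (hearly _ _ ?_).trans (by gcongr)
        rw [Nat.pair_unpair]
        exact Finset.mem_range.1 hm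
    rw [Finset.sum_const, Finset.card_range, nsmul_eq_mul] at h1
    calc _ ≤ _ := h1
      _ = 2 * lam * N * (q * n) * ‖z‖ := by ring
      _ ≤ 2 * lam * N * (q * (n + 1)) * ‖z‖ := by gcongr; linarith
      _ ≤ _ := by gcongr
  have hsplit := apply_eq_arrayTail_add_sum e (n + 1) z hBe φ
  rw [Finset.sum_range_succ] at hsplit
  have hlast : (e n.unpair.1).coord n.unpair.2 (z n.unpair.1) *
      φ (lp.single ∞ n.unpair.1 (x n.unpair.1 n.unpair.2)) =
      φ (lp.single ∞ k (x k j)) * (e k).coord j (z k) := by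
    rw [hn, Nat.unpair_pair, mul_comm]
  rw [hlast] at hsplit
  rw [hsplit, ← add_assoc, add_sub_cancel_right]
  refine (abs_add_le _ _).trans ((add_le_add hT hE).trans_eq ?_)
  ring

/-- An operator with large diagonal is, up to a small perturbation, the factor of a diagonal
operator with almost as large entries. -/
theorem exists_almost_diagonal [∀ k, CompleteSpace (X k)] {e : ∀ k, SchauderBasis ℝ (X k)}
    (he : ∀ k j, ‖e k j‖ = 1) (curved : UniformlyAsymptoticallyCurved e)
    {lam : ℝ} (hlam : 1 ≤ lam) (hproj : ∀ k n, ‖SchauderBasis.proj (e k) n‖ ≤ lam)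
    (T : lp X ∞ →L[ℝ] lp X ∞) {C η δ : ℝ}
    (hδ0 : 0 ≤ δ) (hδ : ∀ k j, δ ≤ |arrayDiagonal e T k j|)
    (hrep : ∀ k, PlayerIIWinsRep (e k) C η) {θ : ℝ} (hθ : 0 < θ) :
    ∃ (A B D : lp X ∞ →L[ℝ] lp X ∞) (d : ℕ → ℕ → ℝ), ‖A‖ ≤ lam * √(C + η) ∧ ‖B‖ ≤ √(C + η) ∧
      ‖(A.comp T).comp B - D‖ ≤ θ ∧ (∀ k j, (1 - η) * δ ≤ |d k j|) ∧
      ∀ k j (z : lp X ∞), (e k).coord j ((D z : lp X ∞) k) = d k j * (e k).coord j (z k) := by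
  set s := √(C + η) with hs
  have hs0 : 0 ≤ s := Real.sqrt_nonneg _
  have hlam0 : 0 ≤ lam := by linarith
  -- `M` bounds the functionals `f k j ∘ T`, `N` the images `T (x k j)`, and `Q` is the resulting
  -- constant in the row estimate; the `2` in `hρQ` is the sum of the geometric series over a row
  -- index.
  set M := s * (2 * lam) * ‖T‖ with hM
  set N := ‖T‖ * s with hN
  have hN0 : 0 ≤ N := by positivity
  set Q := 3 * lam * (s + 4 * lam + 4 * lam * M) + 2 * lam * N with hQ
  have hQ0 : 0 ≤ Q := by positivity
  obtain ⟨ρ, hρ, hρ1, hρQ⟩ : ∃ ρ : ℝ, 0 < ρ ∧ ρ ≤ 1 ∧ ρ * Q * 2 ≤ θ := by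
    refine ⟨min 1 (θ / (2 * Q + 1)), lt_min one_pos (by positivity), min_le_left _ _, ?_⟩
    calc min 1 (θ / (2 * Q + 1)) * Q * 2 ≤ θ / (2 * Q + 1) * Q * 2 := by
          gcongr; exact min_le_right _ _
      _ = θ * (2 * Q / (2 * Q + 1)) := by ring
      _ ≤ θ * 1 := by
          gcongr
          rw [div_le_one (by positivity)]
          linarith
      _ = θ := mul_one θ
  obtain ⟨x, f, thr, hx, hf, hdiag, hearly, hbase, hlate, htail⟩ :=
    exists_simultaneous_play curved T hδ0 hδ hrep (α := fun n => ρ * (1 / 8) ^ n)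
      (fun n => by positivity)
  have hxn : ∀ k j, ‖x k j‖ ≤ s := fun k j => by simpa [he] using (hx k).norm_le j
  have hfn : ∀ k j, ‖f k j‖ ≤ s * (2 * lam) := fun k j => ((hf k).norm_le j).trans <| by
    gcongr
    exact ContinuousLinearMap.opNorm_le_bound _ (by positivity) fun z =>
      SchauderBasis.abs_coord_le (he k) (hproj k) j z
  choose Bk hBk hBklim using fun k => exists_synthesis_operator (e k) (hx k)
  have hfs : ∀ k i, Summable fun j => ‖f k j (e k i) • e k j‖ := fun k i => by
    refine Summable.of_norm_bounded_eventually_nat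
      (g := fun j => (1 / 2 : ℝ) ^ j) summable_geometric_two ?_
    filter_upwards [eventually_gt_atTop i] with j hj
    rw [norm_norm, norm_smul, he, mul_one, Real.norm_eq_abs]
    have hj' : j ≤ Nat.pair k j := Nat.right_le_pair k j
    have h1 := hbase k j i (hj.trans_le hj')
    rw [he, mul_one] at h1
    calc _ ≤ _ := h1
      _ ≤ 1 * (1 / 8) ^ Nat.pair k j := by gcongr
      _ ≤ (1 / 2) ^ j := by
        have := eighth_pow_le (Nat.zero_le _) hj'
        simpa using this
  choose Ak hAk hAkc using fun k => exists_analysis_operator (e k) hlam0 (hproj k) (hf k) (hfs k)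
  have hcomp : ∀ (c : ℝ) (L : ∀ k, X k →L[ℝ] X k), 0 ≤ c → (∀ k, ‖L k‖ ≤ c) →
      ∃ S : lp X ∞ →L[ℝ] lp X ∞, ‖S‖ ≤ c ∧ ∀ z k, (S z : lp X ∞) k = L k (z k) :=
    fun c L hc hL => ⟨lp.mapCLM ∞ L hc hL, lp.norm_mapCLM_le ∞ L hc hL, fun z k => rfl⟩
  obtain ⟨B, hBn, hB⟩ := hcomp s Bk hs0 hBk
  obtain ⟨A, hAn, hA⟩ := hcomp (lam * s) Ak (by positivity) hAk
  have hBke : ∀ k j, Bk k (e k j) = x k j := fun k j => by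
    refine tendsto_nhds_unique (hBklim k (e k j)) (tendsto_const_nhds.congr' ?_)
    filter_upwards [eventually_gt_atTop j] with n hn
    simp [SchauderBasis.coord_basis, hn]
  have hBe : ∀ k j, B (lp.single ∞ k (e k j)) = lp.single ∞ k (x k j) := fun k j => by
    refine lp.ext (funext fun k' => ?_)
    rw [hB]
    by_cases h : k' = k
    · subst h
      rw [lp.single_apply_self, lp.single_apply_self, hBke]
    · rw [lp.single_apply_ne _ _ _ h, lp.single_apply_ne _ _ _ h, map_zero]
  have hBlim : ∀ (z : lp X ∞) k, Tendsto (fun n => ∑ j ∈ Finset.range n,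
      (e k).coord j (z k) • x k j) atTop (𝓝 ((B z : lp X ∞) k)) := fun z k => by
    rw [hB]; exact hBklim k (z k)
  let φ : ℕ → ℕ → StrongDual ℝ (lp X ∞) := fun k j => (f k j).comp ((lp.evalCLM ℝ X ∞ k).comp T)
  have hφ : ∀ k j z, φ k j z = f k j ((T z : lp X ∞) k) := fun k j z => rfl
  have hφM : ∀ k j, ‖φ k j‖ ≤ M := fun k j =>
    ContinuousLinearMap.opNorm_le_bound _ (by positivity) fun z => by
      rw [hM, mul_assoc]
      refine (ContinuousLinearMap.le_of_opNorm_le _ (hfn k j) _).trans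
        (mul_le_mul_of_nonneg_left ?_ (by positivity))
      exact (lp.norm_apply_le_norm ENNReal.top_ne_zero (T z) k).trans (T.le_opNorm z)
  let d : ℕ → ℕ → ℝ := fun k j => φ k j (lp.single ∞ k (x k j))
  let r : ℕ → ℕ → StrongDual ℝ (lp X ∞) := fun k j =>
    (φ k j).comp B - d k j • ((e k).coord j).comp (lp.evalCLM ℝ X ∞ k)
  have hr : ∀ k j z, r k j z = φ k j (B z) - d k j * (e k).coord j (z k) := fun k j z => rfl
  have hrn : ∀ k j, ‖r k j‖ ≤ ρ * Q * (1 / 2) ^ j := fun k j =>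
    ContinuousLinearMap.opNorm_le_bound _ (by positivity) fun z => by
      rw [hr, Real.norm_eq_abs]
      refine abs_row_le he hlam hproj hs0 hBn hBlim hBe hρ.le hρ1 hN0 (φ k j) (hφM k j)
        (thr := thr k j) (htail k j) (fun k' j' h => (hearly k j k' j' h).trans ?_)
        (fun k' j' h => ?_) z
      · refine mul_le_mul_of_nonneg_left ((T.le_opNorm _).trans ?_) (by positivity)
        rw [lp.norm_single (by simp)]
        exact mul_le_mul_of_nonneg_left (hxn k' j') (norm_nonneg T)
      · obtain ⟨w, hw, hw'⟩ := hlate k' j'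
        exact ⟨w, hw, hw' k j h⟩
  choose Rk hRk hRkc using fun k => exists_analysis_operator_of_summable (e k) (he k) (r k)
    (hasSum_geometric_two.mul_left (ρ * Q)) (hrn k)
  obtain ⟨R, hRn, hR⟩ := exists_linfty_lift Rk (by positivity) hRk
  -- `R` collects the off-diagonal parts of all rows, so subtracting it leaves an exactly diagonal
  -- operator.
  refine ⟨A, B, (A.comp T).comp B - R, d, hAn, hBn, ?_, hdiag, fun k j z => ?_⟩
  · rw [sub_sub_cancel]
    exact hRn.trans hρQ
  · rw [sub_apply, lp.coeFn_sub, Pi.sub_apply, map_sub, hR, hRkc, hr]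
    have : (e k).coord j (((A.comp T).comp B z : lp X ∞) k) = φ k j (B z) := by
      rw [ContinuousLinearMap.comp_apply, ContinuousLinearMap.comp_apply, hA, hAkc, hφ]
    rw [this, sub_sub_cancel]

end Arrays

/-! ### Inverting the diagonal operator and absorbing the error. -/

/-- A bound on the product of the norms does not survive suprema over `k` taken separately.
Rescaling bounds each factor uniformly, so the factors can be assembled summand by summand. -/
theorem IdFactorsThrough.exists_norm_le_one {X : Type*} [NormedAddCommGroup X] [NormedSpace ℝ X]
    [Nontrivial X] {κ : ℝ} {D : X →L[ℝ] X} (h : IdFactorsThrough κ D) :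
    ∃ A B : X →L[ℝ] X, ‖A‖ ≤ 1 ∧ ‖B‖ ≤ κ ∧ ∀ x, A (D (B x)) = x := by
  obtain ⟨A, B, hAB, hid⟩ := h
  have hA : ‖A‖ ≠ 0 := fun h0 => by
    obtain ⟨v, hv⟩ := exists_ne (0 : X)
    have := congrArg (fun L : X →L[ℝ] X => L v) hid
    rw [norm_eq_zero.1 h0] at this
    exact hv (by simpa using this.symm)
  refine ⟨‖A‖⁻¹ • A, ‖A‖ • B, ?_, ?_, fun x => ?_⟩
  · rw [norm_smul, norm_inv, norm_norm, inv_mul_cancel₀ hA]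
  · rw [norm_smul, norm_norm]; exact hAB
  · simp only [smul_apply, map_smul]
    rw [smul_smul, mul_inv_cancel₀ hA, one_smul]
    exact congrArg (fun L : X →L[ℝ] X => L x) hid

/-- Invertibility is the Neumann series; the norm bound follows from `V = 1 + V * (1 - U)`. -/
theorem exists_left_inverse_of_norm_one_sub_le {Z : Type*} [NormedAddCommGroup Z]
    [NormedSpace ℝ Z] [CompleteSpace Z] {U : Z →L[ℝ] Z} {τ : ℝ} (hτ : τ < 1) (hU : ‖1 - U‖ ≤ τ) :
    ∃ V : Z →L[ℝ] Z, ‖V‖ ≤ (1 - τ)⁻¹ ∧ V * U = 1 := by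
  obtain ⟨u, hu⟩ : IsUnit U := by
    have := isUnit_one_sub_of_norm_lt_one (hU.trans_lt hτ)
    rwa [sub_sub_cancel] at this
  have hVU : (↑u⁻¹ : Z →L[ℝ] Z) * U = 1 := by rw [← hu]; exact u.inv_mul
  refine ⟨↑u⁻¹, ?_, hVU⟩
  set V : Z →L[ℝ] Z := ↑u⁻¹
  have h1 : V = 1 + V * (1 - U) := by rw [mul_sub, hVU, mul_one]; abel
  have h2 : ‖V‖ ≤ 1 + ‖V‖ * τ := by
    calc ‖V‖ = ‖1 + V * (1 - U)‖ := congrArg norm h1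
      _ ≤ ‖(1 : Z →L[ℝ] Z)‖ + ‖V * (1 - U)‖ := norm_add_le _ _
      _ ≤ 1 + ‖V‖ * τ := add_le_add ContinuousLinearMap.norm_id_le
        ((norm_mul_le _ _).trans (by gcongr))
  rw [← one_div, le_div_iff₀ (by linarith)]
  linarith

section Arrays

variable {X : ℕ → Type*} [∀ k, NormedAddCommGroup (X k)] [∀ k, NormedSpace ℝ (X k)]

/-- A diagonal operator on the `ℓ^∞`-sum with entries bounded below factors the identity, by the
uniform diagonal factorization property of the bases. -/
theorem exists_factorization_of_diagonal {e : ∀ k, SchauderBasis ℝ (X k)}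
    (he : ∀ k j, ‖e k j‖ = 1) {K : ℝ → ℝ} (hK : ∀ k, HasDiagonalFactorizationProperty (e k) K)
    {δ : ℝ} (hδ : 0 < δ) (hKδ : 0 < K δ) {c ε : ℝ} (hc : 0 < c) (hε : 0 < ε)
    {D : lp X ∞ →L[ℝ] lp X ∞} {d : ℕ → ℕ → ℝ} (hd : ∀ k j, c * δ ≤ |d k j|)
    (hD : ∀ k j (z : lp X ∞), (e k).coord j ((D z : lp X ∞) k) = d k j * (e k).coord j (z k)) :
    ∃ A B : lp X ∞ →L[ℝ] lp X ∞, ‖A‖ ≤ 1 ∧ ‖B‖ ≤ K δ + ε ∧ ∀ z, A (D (B z)) = c • z := by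
  -- Coordinates determine vectors within each summand, so a diagonal `D` acts summand by summand
  -- even though the array does not span the whole space.
  have hblock : ∀ k (z : lp X ∞), (D z : lp X ∞) k = diagonalBlock D k (z k) := fun k z =>
    (e k).coord_ext fun j => by
      rw [hD, diagonalBlock_apply, hD, lp.single_apply_self]
  -- Dividing by `c` restores the lower bound `δ`, so the constant is `K δ` and no continuity of `K`
  -- is needed.
  have hentry : ∀ k j m, (e k).coord m ((c⁻¹ • diagonalBlock D k) (e k j)) =
      c⁻¹ * (d k m * if m = j then 1 else 0) := fun k j m => by
    rw [smul_apply, map_smul, smul_eq_mul, diagonalBlock_apply, hD, lp.single_apply_self,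
      SchauderBasis.coord_basis]
  have hfac : ∀ k, ∃ A B : X k →L[ℝ] X k, ‖A‖ ≤ 1 ∧ ‖B‖ ≤ K δ + ε ∧
      ∀ x, A ((c⁻¹ • diagonalBlock D k) (B x)) = x := fun k => by
    have : Nontrivial (X k) := ⟨e k 0, 0, fun h => by simpa [h] using he k 0⟩
    refine IdFactorsThrough.exists_norm_le_one (hK k δ hδ _ (fun m j hjm => ?_) ?_ ε hε)
    · rw [hentry, if_neg (Ne.symm hjm), mul_zero, mul_zero]
    · refine le_ciInf fun j => ?_
      rw [hentry, if_pos rfl, mul_one, abs_mul, abs_inv, abs_of_pos hc, ← div_eq_inv_mul,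
        le_div_iff₀ hc, mul_comm]
      exact hd k j
  choose A B hA hB hAB using hfac
  have hκ : 0 ≤ K δ + ε := by positivity
  refine ⟨lp.mapCLM ∞ A zero_le_one hA, lp.mapCLM ∞ B hκ hB, lp.norm_mapCLM_le _ _ _ _,
    lp.norm_mapCLM_le _ _ _ _, fun z => lp.ext (funext fun k => ?_)⟩
  change A k ((D (lp.mapCLM ∞ B hκ hB z) : lp X ∞) k) = c • z k
  rw [hblock]
  change A k (diagonalBlock D k (B k (z k))) = c • z k
  have h := hAB k (z k)
  rw [smul_apply, map_smul] at h
  rw [← h, smul_smul, mul_inv_cancel₀ hc.ne', one_smul, h]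

end Arrays

/-- One factor `(1 - η)⁻¹` comes from rescaling the diagonal, the other from the Neumann series. -/
theorem exists_small_parameter {lam C κ ε : ℝ} (hε : 0 < ε) :
    ∃ η : ℝ, 0 < η ∧ η < 1 ∧
      (1 - η)⁻¹ * (1 - η)⁻¹ * (lam * (C + η)) * (κ + η) ≤ lam * C * κ + ε := by
  have hcont : ContinuousAt (fun η : ℝ =>
      (1 - η)⁻¹ * (1 - η)⁻¹ * (lam * (C + η)) * (κ + η)) 0 := by
    have : ContinuousAt (fun η : ℝ => (1 - η)⁻¹) 0 :=
      ContinuousAt.inv₀ (by fun_prop) (by norm_num)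
    fun_prop
  have hlt : (fun η : ℝ => (1 - η)⁻¹ * (1 - η)⁻¹ * (lam * (C + η)) * (κ + η)) 0 <
      lam * C * κ + ε := by
    simp only [sub_zero, inv_one, one_mul, add_zero]
    linarith
  have h1 : ∀ᶠ η in 𝓝[>] (0 : ℝ), (1 - η)⁻¹ * (1 - η)⁻¹ * (lam * (C + η)) * (κ + η) <
      lam * C * κ + ε := (hcont.eventually_lt_const hlt).filter_mono nhdsWithin_le_nhds
  have h2 : ∀ᶠ η in 𝓝[>] (0 : ℝ), η ∈ Set.Ioo (0 : ℝ) 1 := Ioo_mem_nhdsGT one_pos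
  obtain ⟨η, hη, hη'⟩ := (h1.and h2).exists
  exact ⟨η, hη'.1, hη'.2, hη.le⟩

theorem theorem3p6 {X : ℕ → Type*} [∀ k, NormedAddCommGroup (X k)] [∀ k, NormedSpace ℝ (X k)]
    [∀ k, CompleteSpace (X k)] (e : ∀ k, SchauderBasis ℝ (X k))
    (e_normalized : ∀ k j, ‖e k j‖ = 1)
    (curved : UniformlyAsymptoticallyCurved e)
    (C lam : ℝ) (hC : 1 ≤ C) (hlam : 1 ≤ lam)
    (K : ℝ → ℝ) (hK : ∀ t : ℝ, 0 < t → 0 < K t)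
    (basis_constant : ∀ k, ((e k).nnnormProjBound : ℝ) ≤ lam)
    (diagonal_factorization : ∀ k, HasDiagonalFactorizationProperty (e k) K)
    (reproducible : SimultaneouslyStrategicallyReproducible e C)
    (T : lp X ∞ →L[ℝ] lp X ∞) (δ : ℝ)
    (hδ : δ = ⨅ kj : ℕ × ℕ, |arrayDiagonal e T kj.1 kj.2|) (hδ_pos : 0 < δ) :
    IdAlmostFactorsThrough (lam * C ^ 2 * K δ) T := by
  intro ε hε
  have hKδ := hK δ hδ_pos
  obtain ⟨η, hη0, hη1, hη⟩ := exists_small_parameter (lam := lam) (C := C) (κ := K δ) hε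
  have hc : 0 < 1 - η := by linarith
  have hκ : 0 < K δ + η := by positivity
  have hproj : ∀ k n, ‖SchauderBasis.proj (e k) n‖ ≤ lam := fun k n =>
    (SchauderBasis.norm_proj_le_nnnormProjBound (e k) n).trans (basis_constant k)
  have hdiag : ∀ k j, δ ≤ |arrayDiagonal e T k j| := fun k j => by
    rw [hδ]
    exact ciInf_le (f := fun kj : ℕ × ℕ => |arrayDiagonal e T kj.1 kj.2|)
      ⟨0, by rintro _ ⟨_, rfl⟩; exact abs_nonneg _⟩ (k, j)
  -- `θ` is chosen so that `(1 - η)⁻¹ * θ * (K δ + η) = η`, the error after conjugating by the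
  -- factors of `D`.
  obtain ⟨A, B, D, d, hA, hB, hABD, hd, hD⟩ := exists_almost_diagonal e_normalized curved hlam
    hproj T hδ_pos.le hdiag (fun k => reproducible k η hη0)
    (θ := η * (1 - η) / (K δ + η)) (by positivity)
  obtain ⟨A', B', hA', hB', hAB'⟩ := exists_factorization_of_diagonal e_normalized
    diagonal_factorization hδ_pos hKδ hc hη0 hd hD
  set U : lp X ∞ →L[ℝ] lp X ∞ := (1 - η)⁻¹ • (A' * (A * T * B) * B') with hU
  have hU1 : 1 - U = (1 - η)⁻¹ • (A' * (D - A * T * B) * B') := by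
    have h1 : (1 : lp X ∞ →L[ℝ] lp X ∞) = (1 - η)⁻¹ • (A' * D * B') := by
      refine ContinuousLinearMap.ext fun z => ?_
      change z = (1 - η)⁻¹ • A' (D (B' z))
      rw [hAB', smul_smul, inv_mul_cancel₀ hc.ne', one_smul]
    rw [mul_sub, sub_mul, smul_sub, ← h1]
  have hUn : ‖1 - U‖ ≤ η := by
    have h2 : ‖D - A * T * B‖ ≤ η * (1 - η) / (K δ + η) := by rw [norm_sub_rev]; exact hABD
    rw [hU1, norm_smul, norm_inv, Real.norm_of_nonneg hc.le]
    calc (1 - η)⁻¹ * ‖A' * (D - A * T * B) * B'‖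
        ≤ (1 - η)⁻¹ * (1 * (η * (1 - η) / (K δ + η)) * (K δ + η)) := by
          gcongr
          refine (norm_mul_le _ _).trans (mul_le_mul ((norm_mul_le _ _).trans ?_) hB'
            (norm_nonneg _) (by positivity))
          exact mul_le_mul hA' h2 (norm_nonneg _) zero_le_one
      _ = η := by field_simp
  obtain ⟨V, hV, hVU⟩ := exists_left_inverse_of_norm_one_sub_le hη1 hUn
  refine ⟨(1 - η)⁻¹ • (V * A' * A), B * B', ?_, ?_⟩
  · have hs : √(C + η) * √(C + η) = C + η := Real.mul_self_sqrt (by linarith)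
    have h1 : ‖(1 - η)⁻¹ • (V * A' * A)‖ ≤ (1 - η)⁻¹ * ((1 - η)⁻¹ * 1 * (lam * √(C + η))) := by
      rw [norm_smul, norm_inv, Real.norm_of_nonneg hc.le]
      gcongr
      refine (norm_mul_le _ _).trans (mul_le_mul ((norm_mul_le _ _).trans ?_) hA
        (norm_nonneg _) (by positivity))
      exact mul_le_mul hV hA' (norm_nonneg _) (by positivity)
    have h2 : ‖B * B'‖ ≤ √(C + η) * (K δ + η) :=
      (norm_mul_le _ _).trans (mul_le_mul hB hB' (norm_nonneg _) (Real.sqrt_nonneg _))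
    calc _ ≤ (1 - η)⁻¹ * ((1 - η)⁻¹ * 1 * (lam * √(C + η))) * (√(C + η) * (K δ + η)) :=
          mul_le_mul h1 h2 (norm_nonneg _) (by positivity)
      _ = (1 - η)⁻¹ * (1 - η)⁻¹ * (lam * (√(C + η) * √(C + η))) * (K δ + η) := by ring
      _ ≤ lam * C * K δ + ε := by rw [hs]; exact hη
      -- The construction yields `lam * C * K δ`; as `C ≥ 1`, this is at least as good as the stated
      -- constant.
      _ ≤ lam * C ^ 2 * K δ + ε := by
          have : C ≤ C ^ 2 := by nlinarith
          gcongr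
  · change (1 - η)⁻¹ • (V * A' * A) * T * (B * B') = 1
    rw [← hVU, hU]
    simp only [smul_mul_assoc, mul_smul_comm, mul_assoc]
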